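/- **Theorem 2.3.** Let $0<\theta<1$ and let $[a,b]\subset(-1,\infty)$. For $q\in[a,b]$ let $X_1,X_2,\ldots$ be i.i.d. words under $\mathbf P_q$ with $\mathbf P_q(X_1=i)=c\,(i+q)^{-1/\theta}$, $i\ge1$, where $c^{-1}=\sum_{i\ge1}(i+q)^{-1/\theta}$. Let $R_k$ be the number of different words among $X_1,\ldots,X_k$, with $R_0=0$. Let $A:[0,1]\to\mathbb R$ be the sum of a step function and a piecewise continuously differentiable function, with $A(t)=0$ on $[0,\delta]$ for some $\delta\in(0,1)$, $A(1)=0$ and $\int_0^1\log t\,dA(t)=1$. Put $$\widehat\theta=\widehat\theta_n=\int_0^1\log^+R_{[nt]}\,dA(t).$$ If $0<\widehat\theta<1$, then for $x>-1$ and $k\ge 0$ put $$r_{n,x}(k)=\sum_{i\ge1}\bigl(1-(1-\widehat p_i)^k\bigr),\qquad \widehat p_i=\frac{(i+x)^{-1/\widehat\theta}}{\sum_{j\ge1}(j+x)^{-1/\widehat\theta}}.$$ Call $x>-1$ a *shift estimate* at $n$ if $0<\widehat\theta_n<1$ and $r_{n,x}(n)=R_n$. Let $\widehat Z_n$ and,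 for a shift estimate $\widehat q_n$ at $n$, $\widetilde Z_n$ be the piecewise linear functions on $[0,1]$ with nodes $k/n$, $0\le k\le n$, and $$\widehat Z_n(k/n)=\frac{R_k-(k/n)^{\widehat\theta}R_n}{\sqrt{R_n}},\qquad \widetilde Z_n(k/n)=\frac{R_k-r_{n,\widehat q_n}(k)}{\sqrt{R_n}}.$$ Then: 1. for every $q\in[a,b]$, $\mathbf P_q$-almost surely a shift estimate exists for all sufficiently large $n$; 2. for every $q\in[a,b]$, $\mathbf P_q$-almost surely, for every choice of shift estimates $\widehat q_n$ (for all large $n$), $\sup_{0\le t\le1}|\widehat Z_n(t)-\widetilde Z_n(t)|\to0$ as $n\to\infty$; 3. the almost sure statements are uniform in $q\in[a,b]$: for every $\varepsilon>0$, $$\lim_{N\to\infty}\ \sup_{q\in[a,b]}\mathbf P_q\Bigl(\exists\,n\ge N:\ \text{there is no shift estimate at } n,\ \text{or } \sup_{0\le t\le1}|\widehat Z_n(t)-\widetilde Z_n(t)|>\varepsilon \text{ for some shift estimate } \widehat q_n\Bigr)=0 .$$ -/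

import Mathlib

open Filter Topology MeasureTheory ProbabilityTheory

noncomputable section

namespace TextBridge

/-- The Hurwitz zeta series `∑_{i ≥ 0} (i + x)^{-α}`. -/
def hurwitzSeries (α x : ℝ) : ℝ := ∑' i : ℕ, ((i : ℝ) + x) ^ (-α)

/-- The Zipf-Mandelbrot probability `c (i + q)^{-1/θ}` of the word with number `i ≥ 1`,
where `c = 1 / ∑_{i ≥ 1} (i + q)^{-1/θ}` is the normalizing constant. -/
def zmProb (θ q : ℝ) (i : ℕ) : ℝ :=
  (hurwitzSeries (1 / θ) (q + 1))⁻¹ * ((i : ℝ) + q) ^ (-(1 / θ))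

/-- The words `X 0, X 1, …` of a text are i.i.d. under the probability measure `P`, with the
Zipf-Mandelbrot distribution on the word numbers `1, 2, …`. -/
structure IsZMText {Ω : Type*} [MeasurableSpace Ω] (P : Measure Ω) (X : ℕ → Ω → ℕ)
    (θ q : ℝ) : Prop where
  prob : IsProbabilityMeasure P
  meas : ∀ j, Measurable (X j)
  indep : iIndepFun X P
  law : ∀ j i, 1 ≤ i → P {ω | X j ω = i} = ENNReal.ofReal (zmProb θ q i)

/-- `R_k`: the number of different words among the first `k` words of the text `w`. -/
def numDistinct (w : ℕ → ℕ) (k : ℕ) : ℕ := ((Finset.range k).image w).card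

/-- A step function on `[0,1]`: constant between consecutive points of a finite set. -/
def IsStepFun (S : ℝ → ℝ) : Prop :=
  ∃ F : Finset ℝ, ∀ x y, 0 ≤ x → x ≤ y → y ≤ 1 → (∀ z ∈ F, z ∉ Set.Icc x y) → S x = S y

/-- A continuous, piecewise continuously differentiable function on `[0,1]` (`C¹` up to the end
points on each interval of a finite partition). -/
def IsPiecewiseC1 (B : ℝ → ℝ) : Prop :=
  ContinuousOn B (Set.Icc 0 1) ∧
    ∃ F : Finset ℝ, ∀ x y, 0 ≤ x → x < y → y ≤ 1 → (∀ z ∈ F, z ∉ Set.Ioo x y) →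
      ContDiffOn ℝ 1 B (Set.Icc x y)

/-- The Lebesgue-Stieltjes integral `∫₀¹ f dA` for a function `A` that vanishes outside `(0,1)`
and is the sum of a step function and a piecewise `C¹` function on `[0,1]`: the atoms of `dA` are
the jumps `A(x+) - A(x-)`, and its absolutely continuous part has the density `A'`. -/
def stieltjesIntegral (f A : ℝ → ℝ) : ℝ :=
  (∑ᶠ x : ℝ, f x * (Function.rightLim A x - Function.leftLim A x)) +
    ∫ t in (0 : ℝ)..1, f t * deriv A t

/-- The admissible weight functions `A` on `[0,1]`, extended by zero to the real line. -/
structure IsWeight (A : ℝ → ℝ) : Prop where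
  zero_left : ∃ δ : ℝ, 0 < δ ∧ δ < 1 ∧ ∀ t ≤ δ, A t = 0
  zero_right : ∀ t, 1 ≤ t → A t = 0
  regular : ∃ S B : ℝ → ℝ, IsStepFun S ∧ IsPiecewiseC1 B ∧
    ∀ t ∈ Set.Icc (0 : ℝ) 1, A t = S t + B t
  integral_log : stieltjesIntegral Real.log A = 1

/-- The estimate `θ̂ = ∫₀¹ log⁺ R_{[nt]} dA(t)`. -/
def thetaHat (A : ℝ → ℝ) (w : ℕ → ℕ) (n : ℕ) : ℝ :=
  stieltjesIntegral (fun t => Real.posLog (numDistinct w ⌊(n : ℝ) * t⌋₊)) A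

/-- `∑_{i ≥ 1} (1 - (1 - p_i)^k)` for the Zipf-Mandelbrot law with parameters `θ`, `q`. -/
def meanDistinct (θ q : ℝ) (k : ℕ) : ℝ :=
  ∑' i : ℕ, (1 - (1 - zmProb θ q (i + 1)) ^ k)

/-- `x` is a value of the shift estimate `q̂` for the first `n` words of the text `w`: the
parameters `θ̂`, `x` define a Zipf-Mandelbrot law, and `r(n) = R_n`. -/
def IsShiftEstimate (A : ℝ → ℝ) (w : ℕ → ℕ) (n : ℕ) (x : ℝ) : Prop :=
  0 < thetaHat A w n ∧ thetaHat A w n < 1 ∧ -1 < x ∧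
    meanDistinct (thetaHat A w n) x n = numDistinct w n

/-- The piecewise linear function of `t ∈ [0,1]` with the value `v k` at `t = k/n`. -/
def interpolate (v : ℕ → ℝ) (n : ℕ) (t : ℝ) : ℝ :=
  v ⌊(n : ℝ) * t⌋₊ + ((n : ℝ) * t - ⌊(n : ℝ) * t⌋₊) * (v (⌊(n : ℝ) * t⌋₊ + 1) - v ⌊(n : ℝ) * t⌋₊)

/-- The power-law bridge `Ẑ_n`. -/
def powerBridge (A : ℝ → ℝ) (w : ℕ → ℕ) (n : ℕ) : ℝ → ℝ :=
  interpolate (fun k => ((numDistinct w k : ℝ) -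
    ((k : ℝ) / n) ^ thetaHat A w n * numDistinct w n) / √(numDistinct w n : ℝ)) n

/-- The empirical text bridge `Z̃_n` for the value `x` of the shift estimate. -/
def textBridge (A : ℝ → ℝ) (w : ℕ → ℕ) (n : ℕ) (x : ℝ) : ℝ → ℝ :=
  interpolate (fun k => ((numDistinct w k : ℝ) -
    meanDistinct (thetaHat A w n) x k) / √(numDistinct w n : ℝ)) n

end TextBridge

end

/-! The mean number of different words is `r_{θ,x}(k) = c(θ,x) k^θ + O(1)`, with error at most `x
+ 3` and with `c(θ,x)` strictly increasing in `x`. The occurrences of two different words are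
negatively correlated, so the variance of `R_k` is at most its mean, and Chebyshev's inequality is
summable along `k = m^L` once `L θ ≥ 4`, uniformly in `q`. Monotonicity of `R` fills the gaps
between these times: off an event of small probability `log R_k = log c(θ,q) + θ log k +
O(k^{-1/L})`. As `∫ dA = 0` and `∫ log t dA(t) = 1`, this gives `θ̂_n - θ = O(n^{-1/L})`, whence
`n^{θ̂_n - θ} → 1` and the equation `r_{θ̂,x}(n) = R_n` has its roots in a fixed bounded interval
of `x`. For such a root both bridges subtract `c(θ̂,x) k^θ̂` up to a bounded error, so they differ
by `O(1 / √R_n)`. -/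

noncomputable section

namespace TextBridge

lemma summable_hurwitz {α x : ℝ} (hα : 1 < α) (hx : 0 < x) :
    Summable fun i : ℕ => ((i : ℝ) + x) ^ (-α) := by
  refine ((Real.summable_one_div_nat_add_rpow x α).2 hα).congr fun i => ?_
  have hi : (0 : ℝ) < i + x := by positivity
  rw [abs_of_pos hi, Real.rpow_neg hi.le, one_div]

lemma hurwitzSeries_pos {α x : ℝ} (hα : 1 < α) (hx : 0 < x) : 0 < hurwitzSeries α x :=
  (summable_hurwitz hα hx).tsum_pos (fun i => by positivity) 0 (by positivity)

lemma hurwitzSeries_lt {α x y : ℝ} (hα : 1 < α) (hx : 0 < x) (hxy : x < y) :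
    hurwitzSeries α y < hurwitzSeries α x :=
  have h (i : ℕ) : ((i : ℝ) + y) ^ (-α) < ((i : ℝ) + x) ^ (-α) :=
    Real.rpow_lt_rpow_of_neg (by positivity) (by linarith) (by linarith)
  Summable.tsum_lt_tsum (i := 0) (fun i => (h i).le) (h 0)
    (summable_hurwitz hα (hx.trans hxy)) (summable_hurwitz hα hx)

lemma antitoneOn_hurwitzSeries {α : ℝ} (hα : 1 < α) : AntitoneOn (hurwitzSeries α) (Set.Ioi 0) :=
  StrictAntiOn.antitoneOn fun _ hx _ _ hxy => hurwitzSeries_lt hα hx hxy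

lemma rpow_neg_le_add {β γ α x₀ z : ℝ} (hx₀ : 0 < x₀) (hz : x₀ ≤ z) (hβ : 0 ≤ β) (hβγ : β ≤ γ)
    (hγα : γ ≤ α) : z ^ (-γ) ≤ x₀ ^ (-β) + x₀ ^ (-α) := by
  have hmono : z ^ (-γ) ≤ x₀ ^ (-γ) :=
    Real.rpow_le_rpow_of_nonpos hx₀ hz (by linarith)
  rcases le_total 1 x₀ with h | h
  · have := Real.rpow_le_rpow_of_exponent_le h (neg_le_neg hβγ)
    linarith [Real.rpow_nonneg hx₀.le (-α)]
  · have := Real.rpow_le_rpow_of_exponent_ge hx₀ h (neg_le_neg hγα)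
    linarith [Real.rpow_nonneg hx₀.le (-β)]

lemma continuousOn_hurwitzSeries :
    ContinuousOn (fun p : ℝ × ℝ => hurwitzSeries p.1 p.2) (Set.Ioi 1 ×ˢ Set.Ioi 0) := by
  rintro ⟨α, x⟩ ⟨hα : 1 < α, hx : 0 < x⟩
  obtain ⟨β, hβ1, hβ⟩ := exists_between hα
  obtain ⟨x₀, hx₀, hx₀x⟩ := exists_between hx
  have hmem : Set.Ioo β (α + 1) ×ˢ Set.Ioi x₀ ∈ 𝓝 (α, x) :=
    prod_mem_nhds (Ioo_mem_nhds hβ (lt_add_one α)) (Ioi_mem_nhds hx₀x)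
  refine ContinuousAt.continuousWithinAt (ContinuousOn.continuousAt ?_ hmem)
  refine continuousOn_tsum
    (u := fun i : ℕ => ((i : ℝ) + x₀) ^ (-β) + ((i : ℝ) + x₀) ^ (-(α + 1)))
    (fun i => ?_) ((summable_hurwitz hβ1 hx₀).add (summable_hurwitz (by linarith) hx₀)) ?_
  · refine ContinuousOn.rpow (by fun_prop) (by fun_prop) fun p hp => Or.inl ?_
    have : 0 < p.2 := hx₀.trans hp.2
    positivity
  · rintro i ⟨γ, y⟩ ⟨hγ, hy : x₀ < y⟩
    have : 0 < y := hx₀.trans hy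
    rw [Real.norm_of_nonneg (by positivity)]
    exact rpow_neg_le_add (by positivity) (by linarith) (by linarith) hγ.1.le hγ.2.le

lemma zmProb_succ (θ q : ℝ) (i : ℕ) : zmProb θ q (i + 1) =
    (hurwitzSeries (1 / θ) (q + 1))⁻¹ * ((i : ℝ) + (q + 1)) ^ (-(1 / θ)) := by
  rw [zmProb, Nat.cast_succ, add_assoc, add_comm 1 q]

lemma zmProb_pos {θ q : ℝ} (h0 : 0 < θ) (h1 : θ < 1) (hq : -1 < q) (i : ℕ) :
    0 < zmProb θ q (i + 1) := by
  have hq' : 0 < q + 1 := by linarith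
  have := hurwitzSeries_pos (one_lt_one_div h0 h1) hq'
  rw [zmProb_succ]
  positivity

lemma hasSum_zmProb {θ q : ℝ} (h0 : 0 < θ) (h1 : θ < 1) (hq : -1 < q) :
    HasSum (fun i : ℕ => zmProb θ q (i + 1)) 1 := by
  have hα := one_lt_one_div h0 h1
  have hq' : 0 < q + 1 := by linarith
  have h := (summable_hurwitz hα hq').hasSum.mul_left (hurwitzSeries (1 / θ) (q + 1))⁻¹
  rw [← hurwitzSeries, inv_mul_cancel₀ (hurwitzSeries_pos hα hq').ne'] at h
  simpa only [zmProb_succ] using h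

lemma zmProb_le_one {θ q : ℝ} (h0 : 0 < θ) (h1 : θ < 1) (hq : -1 < q) (i : ℕ) :
    zmProb θ q (i + 1) ≤ 1 :=
  le_hasSum (hasSum_zmProb h0 h1 hq) i fun j _ => (zmProb_pos h0 h1 hq j).le

lemma one_sub_pow_nonneg {p : ℝ} (h0 : 0 ≤ p) (h1 : p ≤ 1) (k : ℕ) : 0 ≤ 1 - (1 - p) ^ k :=
  sub_nonneg.2 (pow_le_one₀ (by linarith) (by linarith))

lemma one_sub_pow_le_mul {p : ℝ} (h1 : p ≤ 1) (k : ℕ) : 1 - (1 - p) ^ k ≤ k * p := by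
  have := one_add_mul_le_pow (a := -p) (by linarith) k
  rw [sub_eq_add_neg 1 p]
  linarith

lemma summable_one_sub_pow {ι : Type*} {p : ι → ℝ} (h0 : ∀ i, 0 ≤ p i) (h1 : ∀ i, p i ≤ 1)
    (hp : Summable p) (k : ℕ) : Summable fun i => 1 - (1 - p i) ^ k :=
  (hp.mul_left (k : ℝ)).of_nonneg_of_le (fun i => one_sub_pow_nonneg (h0 i) (h1 i) k)
    fun i => one_sub_pow_le_mul (h1 i) k

lemma summable_meanDistinct {θ q : ℝ} (h0 : 0 < θ) (h1 : θ < 1) (hq : -1 < q) (k : ℕ) :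
    Summable fun i : ℕ => 1 - (1 - zmProb θ q (i + 1)) ^ k :=
  summable_one_sub_pow (fun i => (zmProb_pos h0 h1 hq i).le) (zmProb_le_one h0 h1 hq)
    (hasSum_zmProb h0 h1 hq).summable k

lemma one_sub_pow_le_exp_neg_mul {p : ℝ} (h1 : p ≤ 1) (k : ℕ) :
    (1 - p) ^ k ≤ Real.exp (-(k * p)) := by
  rw [← mul_neg, Real.exp_nat_mul]
  exact pow_le_pow_left₀ (by linarith) (Real.one_sub_le_exp_neg p) k

lemma exp_neg_mul_le_one_sub_pow_add {p : ℝ} (h0 : 0 ≤ p) (h1 : p ≤ 1) (k : ℕ) :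
    Real.exp (-(k * p)) ≤ (1 - p) ^ k + p := by
  have hexp : Real.exp (-p) ≤ 1 - p + p ^ 2 := by
    have := Real.abs_exp_sub_one_sub_id_le (x := -p) (by rwa [abs_neg, abs_of_nonneg h0])
    linarith [(abs_le.1 this).2, neg_sq p]
  rw [← mul_neg, Real.exp_nat_mul]
  induction k with
  | zero => simpa using h0
  | succ k ih =>
    have hle : Real.exp (-p) ^ k ≤ 1 := pow_le_one₀ (Real.exp_pos _).le (by simpa using h0)
    calc Real.exp (-p) ^ (k + 1) ≤ Real.exp (-p) ^ k * (1 - p + p ^ 2) := by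
          rw [pow_succ]; gcongr
      _ = Real.exp (-p) ^ k * (1 - p) + Real.exp (-p) ^ k * p ^ 2 := by ring
      _ ≤ ((1 - p) ^ k + p) * (1 - p) + 1 * p ^ 2 := by gcongr
      _ = (1 - p) ^ (k + 1) + p := by ring

lemma abs_tsum_one_sub_pow_sub_le {ι : Type*} {p : ι → ℝ} (h0 : ∀ i, 0 ≤ p i)
    (h1 : ∀ i, p i ≤ 1) (hp : Summable p) (k : ℕ) :
    |∑' i, (1 - (1 - p i) ^ k) - ∑' i, (1 - Real.exp (-(k * p i)))| ≤ ∑' i, p i := by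
  have hlow (i : ι) := one_sub_pow_le_exp_neg_mul (h1 i) k
  have hup (i : ι) := exp_neg_mul_le_one_sub_pow_add (h0 i) (h1 i) k
  have hs := summable_one_sub_pow h0 h1 hp k
  have hs' : Summable fun i => 1 - Real.exp (-(k * p i)) :=
    hs.of_nonneg_of_le (fun i => by simpa using mul_nonneg k.cast_nonneg (h0 i))
      fun i => by linarith [hlow i]
  rw [← hs.tsum_sub hs', abs_of_nonneg (tsum_nonneg fun i => by linarith [hlow i])]
  exact (hs.sub hs').tsum_le_tsum (fun i => by linarith [hup i]) hp

lemma tsum_one_sub_exp_neg {ι : Type*} {f : ι → ℝ} (hf : ∀ i, 0 ≤ f i)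
    (hfin : ∀ t > 0, {i | t < f i}.Finite) :
    ∑' i, (1 - Real.exp (-f i)) =
      ∫ t in Set.Ioi 0, ({i | t < f i}.ncard : ℝ) * Real.exp (-t) := by
  let _ : MeasurableSpace ι := ⊤
  have hnn (i : ι) : 0 ≤ 1 - Real.exp (-f i) := by simpa using hf i
  have hcake := lintegral_comp_eq_lintegral_meas_lt_mul (.count : Measure ι) (ae_of_all _ hf)
    measurable_from_top.aemeasurable (g := fun t => Real.exp (-t))
    (fun t _ => Continuous.intervalIntegrable (by fun_prop) 0 t)
    (ae_of_all _ fun t => (Real.exp_pos _).le)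
  have hint (x : ℝ) : ∫ t in (0 : ℝ)..x, Real.exp (-t) = 1 - Real.exp (-x) := by simp
  simp only [hint, lintegral_count] at hcake
  have hmeas : Measurable fun t : ℝ => Measure.count {i | t < f i} :=
    Antitone.measurable fun s t hst => measure_mono fun i (hi : t < f i) => hst.trans_lt hi
  calc ∑' i, (1 - Real.exp (-f i))
      = (∑' i, ENNReal.ofReal (1 - Real.exp (-f i))).toReal := by
        rw [ENNReal.tsum_toReal_eq fun _ => ENNReal.ofReal_ne_top]
        simp only [ENNReal.toReal_ofReal (hnn _)]
    _ = ∫ t in Set.Ioi 0,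
          (Measure.count {i | t < f i} * ENNReal.ofReal (Real.exp (-t))).toReal := by
        rw [hcake, integral_toReal (by fun_prop)]
        filter_upwards [ae_restrict_mem measurableSet_Ioi] with t ht
        exact ENNReal.mul_lt_top (Measure.count_apply_lt_top.2 (hfin t ht)) ENNReal.ofReal_lt_top
    _ = ∫ t in Set.Ioi 0, ({i | t < f i}.ncard : ℝ) * Real.exp (-t) := by
        refine setIntegral_congr_fun measurableSet_Ioi fun t ht => ?_
        have hS : {i | t < f i}.Finite := hfin t ht
        rw [ENNReal.toReal_mul, ENNReal.toReal_ofReal (Real.exp_pos _).le,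
          Measure.count_apply_finite _ hS, Set.ncard_eq_toFinset_card _ hS, ENNReal.toReal_natCast]

lemma setOf_lt_mul_add_rpow {θ s t u : ℝ} (h0 : 0 < θ) (hs : 0 ≤ s) (ht : 0 < t) (hu : 0 < u) :
    {i : ℕ | t < s * ((i : ℝ) + u) ^ (-(1 / θ))} = Set.Iio ⌈(s / t) ^ θ - u⌉₊ := by
  ext i
  have hi : 0 < (i : ℝ) + u := by positivity
  rw [Set.mem_ofPred_eq, Set.mem_Iio, Nat.lt_ceil, lt_sub_iff_add_lt, Real.rpow_neg hi.le,
    ← div_eq_mul_inv, lt_div_comm₀ ht (by positivity), one_div,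
    Real.rpow_inv_lt_iff_of_pos hi.le (by positivity) h0]

lemma abs_natCeil_sub_sub_le {y u : ℝ} (hy : 0 ≤ y) (hu : 0 < u) :
    |(⌈y - u⌉₊ : ℝ) - y| ≤ 1 + u := by
  rw [abs_le]
  refine ⟨by linarith [Nat.le_ceil (y - u)], ?_⟩
  rcases le_total y u with h | h
  · rw [Nat.ceil_eq_zero.2 (sub_nonpos.2 h), Nat.cast_zero]
    linarith
  · linarith [Nat.ceil_lt_add_one (sub_nonneg.2 h)]

lemma div_rpow_mul_exp_neg {θ s t : ℝ} (hs : 0 ≤ s) (ht : 0 < t) :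
    (s / t) ^ θ * Real.exp (-t) = s ^ θ * (Real.exp (-t) * t ^ (1 - θ - 1)) := by
  rw [Real.div_rpow hs ht.le, sub_sub_cancel_left, Real.rpow_neg ht.le]
  ring

lemma integrableOn_div_rpow_mul_exp_neg {θ s : ℝ} (h1 : θ < 1) (hs : 0 ≤ s) :
    IntegrableOn (fun t => (s / t) ^ θ * Real.exp (-t)) (Set.Ioi 0) :=
  IntegrableOn.congr_fun ((Real.GammaIntegral_convergent (sub_pos.2 h1)).const_mul (s ^ θ))
    (fun _ ht => (div_rpow_mul_exp_neg hs ht).symm) measurableSet_Ioi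

lemma integral_div_rpow_mul_exp_neg {θ s : ℝ} (h1 : θ < 1) (hs : 0 ≤ s) :
    ∫ t in Set.Ioi 0, (s / t) ^ θ * Real.exp (-t) = s ^ θ * Real.Gamma (1 - θ) := by
  rw [Real.Gamma_eq_integral (sub_pos.2 h1), ← integral_const_mul]
  exact setIntegral_congr_fun measurableSet_Ioi fun t ht => div_rpow_mul_exp_neg hs ht

lemma abs_tsum_one_sub_exp_neg_sub_le {θ s u : ℝ} (h0 : 0 < θ) (h1 : θ < 1) (hs : 0 ≤ s)
    (hu : 0 < u) :
    |∑' i : ℕ, (1 - Real.exp (-(s * ((i : ℝ) + u) ^ (-(1 / θ))))) - s ^ θ * Real.Gamma (1 - θ)|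
      ≤ 1 + u := by
  set N : ℝ → ℝ := fun t => (⌈(s / t) ^ θ - u⌉₊ : ℝ) with hN
  have hexp : IntegrableOn (fun t : ℝ => Real.exp (-t)) (Set.Ioi 0) := integrableOn_exp_neg_Ioi 0
  have hclose : ∀ t > 0, |(N t - (s / t) ^ θ) * Real.exp (-t)| ≤ (1 + u) * Real.exp (-t) := by
    intro t ht
    rw [abs_mul, abs_of_pos (Real.exp_pos (-t))]
    exact mul_le_mul_of_nonneg_right (abs_natCeil_sub_sub_le (by positivity) hu) (by positivity)
  have hmeas : Measurable N :=
    Measurable.comp (g := fun y : ℝ => (⌈y⌉₊ : ℝ)) (by fun_prop) (by fun_prop)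
  have hdiff : IntegrableOn (fun t => (N t - (s / t) ^ θ) * Real.exp (-t)) (Set.Ioi 0) := by
    refine Integrable.mono' (hexp.const_mul (1 + u)) (by fun_prop) ?_
    exact (ae_restrict_mem measurableSet_Ioi).mono hclose
  have hcount : ∑' i : ℕ, (1 - Real.exp (-(s * ((i : ℝ) + u) ^ (-(1 / θ))))) =
      ∫ t in Set.Ioi 0, N t * Real.exp (-t) := by
    rw [tsum_one_sub_exp_neg (fun i => by positivity) fun t ht => by
      rw [setOf_lt_mul_add_rpow h0 hs ht hu]; exact Set.finite_Iio _]
    refine setIntegral_congr_fun measurableSet_Ioi fun t ht => ?_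
    simp only [setOf_lt_mul_add_rpow h0 hs ht hu, hN, Set.ncard_eq_toFinset_card',
      Set.toFinset_Iio, Nat.card_Iio]
  have hsplit : ∫ t in Set.Ioi 0, N t * Real.exp (-t) =
      (∫ t in Set.Ioi 0, (N t - (s / t) ^ θ) * Real.exp (-t)) + s ^ θ * Real.Gamma (1 - θ) := by
    rw [← integral_div_rpow_mul_exp_neg h1 hs,
      ← integral_add hdiff (integrableOn_div_rpow_mul_exp_neg h1 hs)]
    simp only [sub_mul, sub_add_cancel]
  calc _ = ‖∫ t in Set.Ioi 0, (N t - (s / t) ^ θ) * Real.exp (-t)‖ := by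
        rw [hcount, hsplit, add_sub_cancel_right, Real.norm_eq_abs]
    _ ≤ ∫ t in Set.Ioi 0, (1 + u) * Real.exp (-t) :=
        norm_integral_le_of_norm_le (hexp.const_mul _)
          ((ae_restrict_mem measurableSet_Ioi).mono hclose)
    _ = 1 + u := by rw [integral_const_mul, integral_exp_neg_Ioi_zero, mul_one]

/-- The leading coefficient `c` of the asymptotics `meanDistinct θ x k ∼ c * k ^ θ`. -/
def growthCoeff (θ x : ℝ) : ℝ :=
  ((hurwitzSeries (1 / θ) (x + 1))⁻¹) ^ θ * Real.Gamma (1 - θ)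

lemma abs_meanDistinct_sub_le {θ x : ℝ} (h0 : 0 < θ) (h1 : θ < 1) (hx : -1 < x) (k : ℕ) :
    |meanDistinct θ x k - growthCoeff θ x * (k : ℝ) ^ θ| ≤ x + 3 := by
  have hu : 0 < x + 1 := by linarith
  have hc := inv_pos.2 (hurwitzSeries_pos (one_lt_one_div h0 h1) hu)
  have hpoisson := abs_tsum_one_sub_pow_sub_le (fun i => (zmProb_pos h0 h1 hx i).le)
    (zmProb_le_one h0 h1 hx) (hasSum_zmProb h0 h1 hx).summable k
  have hcount := abs_tsum_one_sub_exp_neg_sub_le h0 h1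
    (mul_nonneg k.cast_nonneg hc.le) hu
  simp only [mul_assoc, ← zmProb_succ] at hcount
  rw [(hasSum_zmProb h0 h1 hx).tsum_eq] at hpoisson
  have hcoeff : (k * (hurwitzSeries (1 / θ) (x + 1))⁻¹) ^ θ * Real.Gamma (1 - θ) =
      growthCoeff θ x * (k : ℝ) ^ θ := by
    rw [growthCoeff, Real.mul_rpow k.cast_nonneg hc.le]
    ring
  rw [hcoeff] at hcount
  calc _ ≤ _ := abs_sub_le _ (∑' i, (1 - Real.exp (-(k * zmProb θ x (i + 1))))) _
    _ ≤ 1 + (1 + (x + 1)) := add_le_add hpoisson hcount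
    _ = x + 3 := by ring

lemma growthCoeff_pos {θ x : ℝ} (h0 : 0 < θ) (h1 : θ < 1) (hx : -1 < x) :
    0 < growthCoeff θ x := by
  have := hurwitzSeries_pos (one_lt_one_div h0 h1) (by linarith : 0 < x + 1)
  have := Real.Gamma_pos_of_pos (sub_pos.2 h1)
  unfold growthCoeff
  positivity

lemma strictMonoOn_growthCoeff {θ : ℝ} (h0 : 0 < θ) (h1 : θ < 1) :
    StrictMonoOn (growthCoeff θ) (Set.Ioi (-1)) := by
  intro x (hx : -1 < x) y _ hxy
  have hα := one_lt_one_div h0 h1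
  have hlt := hurwitzSeries_lt hα (by linarith : 0 < x + 1) (by linarith : x + 1 < y + 1)
  have hpos := hurwitzSeries_pos hα (by linarith : 0 < y + 1)
  have hpos' := hpos.trans hlt
  exact mul_lt_mul_of_pos_right (Real.rpow_lt_rpow (by positivity) (inv_strictAnti₀ hpos hlt) h0)
    (Real.Gamma_pos_of_pos (sub_pos.2 h1))

lemma continuousAt_growthCoeff {θ x : ℝ} (h0 : 0 < θ) (h1 : θ < 1) (hx : -1 < x) :
    ContinuousAt (fun τ => growthCoeff τ x) θ := by
  have hα := one_lt_one_div h0 h1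
  have hx' : 0 < x + 1 := by linarith
  have hz : ContinuousAt (fun τ => hurwitzSeries (1 / τ) (x + 1)) θ :=
    ContinuousAt.comp (g := fun p : ℝ × ℝ => hurwitzSeries p.1 p.2) (f := fun τ => (1 / τ, x + 1))
      (continuousOn_hurwitzSeries.continuousAt
        (prod_mem_nhds (Ioi_mem_nhds hα) (Ioi_mem_nhds hx')))
      ((continuousAt_const.div continuousAt_id h0.ne').prodMk continuousAt_const)
  have hpos := hurwitzSeries_pos hα hx'
  have hΓ : ContinuousAt Real.Gamma (1 - θ) :=
    (Real.differentiableAt_Gamma fun m => by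
      linarith [m.cast_nonneg (α := ℝ)] |> ne_of_gt).continuousAt
  exact ((hz.inv₀ hpos.ne').rpow continuousAt_id (Or.inr h0)).mul
    (hΓ.comp' (f := fun τ => 1 - τ) (by fun_prop))

/- The supergradient `φ'` may be replaced by its constant value at the crossing index, since
`(φ' (p' i) - φ' (p' i₀)) * (p' i - p i) ≥ 0` on both sides of it. -/
lemma tsum_le_tsum_of_crossing {φ φ' : ℝ → ℝ} {s : Set ℝ}
    (hφ : ∀ x ∈ s, ∀ y ∈ s, φ y ≤ φ x + φ' x * (y - x)) (hφ' : AntitoneOn φ' s)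
    {p p' : ℕ → ℝ} (hp : ∀ i, p i ∈ s) (hp' : ∀ i, p' i ∈ s) {m : ℝ} (hm : HasSum p m)
    (hm' : HasSum p' m) (hanti : Antitone p')
    (hcross : ∀ i j, i ≤ j → p i ≤ p' i → p j ≤ p' j)
    (hsum : Summable fun i => φ (p i)) (hsum' : Summable fun i => φ (p' i)) :
    ∑' i, φ (p i) ≤ ∑' i, φ (p' i) := by
  classical
  have hex : ∃ i, p i ≤ p' i := by
    by_contra! hlt
    exact (hasSum_lt (fun i => (hlt i).le) (hlt 0) hm' hm).false
  set i₀ := Nat.find hex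
  have hslope (i : ℕ) : φ' (p' i₀) * (p' i - p i) ≤ φ' (p' i) * (p' i - p i) := by
    rcases le_or_gt i₀ i with h | h
    · exact mul_le_mul_of_nonneg_right (hφ' (hp' i) (hp' i₀) (hanti h))
        (sub_nonneg.2 (hcross _ _ h (Nat.find_spec hex)))
    · exact mul_le_mul_of_nonpos_right (hφ' (hp' i₀) (hp' i) (hanti h.le))
        (sub_nonpos.2 (not_le.1 (Nat.find_min hex h)).le)
  have hgain (i : ℕ) : φ' (p' i₀) * (p' i - p i) ≤ φ (p' i) - φ (p i) := by
    linarith [hslope i, hφ _ (hp' i) _ (hp i)]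
  have := hasSum_le hgain ((hm'.sub hm).mul_left (φ' (p' i₀))) (hsum'.hasSum.sub hsum.hasSum)
  linarith

lemma one_sub_pow_le_add_mul_sub {x y : ℝ} (hx : x ≤ 1) (hy : y ≤ 1) (k : ℕ) :
    1 - (1 - y) ^ k ≤ 1 - (1 - x) ^ k + k * (1 - x) ^ (k - 1) * (y - x) := by
  have h := pow_add_mul_le_add_pow_of_sq_nonneg (a := 1 - x) (b := x - y) (by linarith)
    (sq_nonneg _) (sq_nonneg _) (by linarith) k
  rw [sub_add_sub_cancel] at h
  linarith

lemma antitoneOn_mul_one_sub_pow (k : ℕ) :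
    AntitoneOn (fun x : ℝ => k * (1 - x) ^ (k - 1)) (Set.Icc 0 1) := by
  intro x _ y hy hxy
  have := sub_nonneg.2 hy.2
  simp only
  gcongr

lemma antitone_zmProb {θ q : ℝ} (h0 : 0 < θ) (h1 : θ < 1) (hq : -1 < q) :
    Antitone fun i : ℕ => zmProb θ q (i + 1) := by
  intro i j hij
  have hq' : 0 < q + 1 := by linarith
  have hc := inv_pos.2 (hurwitzSeries_pos (one_lt_one_div h0 h1) hq')
  have hα : -(1 / θ) ≤ 0 := neg_nonpos.2 (one_div_pos.2 h0).le
  simp only [zmProb_succ]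
  exact mul_le_mul_of_nonneg_left
    (Real.rpow_le_rpow_of_nonpos (by positivity) (by gcongr) hα) hc.le

lemma zmProb_div_zmProb_le {θ x y : ℝ} (h0 : 0 < θ) (h1 : θ < 1) (hx : -1 < x) (hxy : x ≤ y)
    {i j : ℕ} (hij : i ≤ j) :
    zmProb θ y (i + 1) / zmProb θ x (i + 1) ≤ zmProb θ y (j + 1) / zmProb θ x (j + 1) := by
  have hx' : 0 < x + 1 := by linarith
  have hy' : 0 < y + 1 := by linarith
  have hcx := inv_pos.2 (hurwitzSeries_pos (one_lt_one_div h0 h1) hx')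
  have hcy := inv_pos.2 (hurwitzSeries_pos (one_lt_one_div h0 h1) hy')
  have hij' : (i : ℝ) ≤ j := Nat.cast_le.2 hij
  simp only [zmProb_succ, mul_div_mul_comm]
  refine mul_le_mul_of_nonneg_left ?_ (by positivity)
  rw [← Real.div_rpow (by positivity) (by positivity),
    ← Real.div_rpow (by positivity) (by positivity)]
  refine Real.rpow_le_rpow_of_nonpos (by positivity) ?_ (neg_nonpos.2 (one_div_pos.2 h0).le)
  rw [div_le_div_iff₀ (by positivity) (by positivity)]
  nlinarith

lemma meanDistinct_mono {θ x y : ℝ} (h0 : 0 < θ) (h1 : θ < 1) (hx : -1 < x) (hxy : x ≤ y)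
    (k : ℕ) : meanDistinct θ x k ≤ meanDistinct θ y k := by
  have hy : -1 < y := hx.trans_le hxy
  have hmem {z : ℝ} (hz : -1 < z) (i : ℕ) : zmProb θ z (i + 1) ∈ Set.Icc 0 1 :=
    ⟨(zmProb_pos h0 h1 hz i).le, zmProb_le_one h0 h1 hz i⟩
  refine tsum_le_tsum_of_crossing (φ := fun p => 1 - (1 - p) ^ k)
    (fun p hp r hr => one_sub_pow_le_add_mul_sub hp.2 hr.2 k) (antitoneOn_mul_one_sub_pow k)
    (hmem hx) (hmem hy) (hasSum_zmProb h0 h1 hx) (hasSum_zmProb h0 h1 hy)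
    (antitone_zmProb h0 h1 hy) (fun i j hij hp => ?_) (summable_meanDistinct h0 h1 hx k)
    (summable_meanDistinct h0 h1 hy k)
  rw [← one_le_div (zmProb_pos h0 h1 hx _)] at hp ⊢
  exact hp.trans (zmProb_div_zmProb_le h0 h1 hx hxy hij)

lemma zmProb_le_of_mem_Icc {θ x₀ x₁ x : ℝ} (h0 : 0 < θ) (h1 : θ < 1) (hx₀ : -1 < x₀)
    (hx : x ∈ Set.Icc x₀ x₁) (i : ℕ) : zmProb θ x (i + 1) ≤
      (hurwitzSeries (1 / θ) (x₁ + 1))⁻¹ * ((i : ℝ) + (x₀ + 1)) ^ (-(1 / θ)) := by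
  have hα := one_lt_one_div h0 h1
  have hx₀' : 0 < x₀ + 1 := by linarith
  have hx' : 0 < x + 1 := by linarith [hx.1]
  have hx₁' : 0 < x₁ + 1 := by linarith [hx.1, hx.2]
  rw [zmProb_succ]
  exact mul_le_mul
    (inv_anti₀ (hurwitzSeries_pos hα hx₁')
      (antitoneOn_hurwitzSeries hα hx' hx₁' (by linarith [hx.2])))
    (Real.rpow_le_rpow_of_nonpos (by positivity) (by linarith [hx.1]) (by linarith))
    (by positivity) (inv_nonneg.2 (hurwitzSeries_pos hα hx₁').le)

lemma continuousOn_zmProb {θ : ℝ} (h0 : 0 < θ) (h1 : θ < 1) (i : ℕ) :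
    ContinuousOn (fun x => zmProb θ x (i + 1)) (Set.Ioi (-1)) := by
  have hα := one_lt_one_div h0 h1
  have hpos {x : ℝ} (hx : x ∈ Set.Ioi (-1)) : 0 < x + 1 := neg_lt_iff_pos_add.1 hx
  have hz : ContinuousOn (fun x => hurwitzSeries (1 / θ) (x + 1)) (Set.Ioi (-1)) :=
    continuousOn_hurwitzSeries.comp (f := fun x : ℝ => (1 / θ, x + 1)) (by fun_prop)
      fun x hx => ⟨hα, hpos hx⟩
  simp only [zmProb_succ]
  refine (hz.inv₀ fun x hx => (hurwitzSeries_pos hα (hpos hx)).ne').mul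
    (ContinuousOn.rpow_const (by fun_prop) fun x hx => Or.inl ?_)
  have := hpos hx
  positivity

lemma continuousOn_meanDistinct {θ x₀ x₁ : ℝ} (h0 : 0 < θ) (h1 : θ < 1) (hx₀ : -1 < x₀) (k : ℕ) :
    ContinuousOn (fun x => meanDistinct θ x k) (Set.Icc x₀ x₁) := by
  refine continuousOn_tsum (fun i => ?_) (((summable_hurwitz (one_lt_one_div h0 h1)
    (neg_lt_iff_pos_add.1 hx₀)).mul_left (hurwitzSeries (1 / θ) (x₁ + 1))⁻¹).mul_left (k : ℝ))
    fun i x hx => ?_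
  · have := (continuousOn_zmProb h0 h1 i).mono fun x (hx : x ∈ Set.Icc x₀ x₁) => hx₀.trans_le hx.1
    fun_prop
  · have hx' := hx₀.trans_le hx.1
    have hle := zmProb_le_one h0 h1 hx' i
    rw [Real.norm_of_nonneg (one_sub_pow_nonneg (zmProb_pos h0 h1 hx' i).le hle k)]
    exact (one_sub_pow_le_mul hle k).trans
      (mul_le_mul_of_nonneg_left (zmProb_le_of_mem_Icc h0 h1 hx₀ hx i) k.cast_nonneg)

section NegativelyCorrelatedEvents

variable {Ω ι : Type*} [MeasurableSpace Ω] [Countable ι] {P : Measure Ω} {E : ι → Set Ω}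

lemma lintegral_tsum_indicator (hE : ∀ i, MeasurableSet (E i)) :
    ∫⁻ ω, ∑' i, (E i).indicator 1 ω ∂P = ∑' i, P (E i) := by
  rw [lintegral_tsum fun i => (measurable_one.indicator (hE i)).aemeasurable]
  simp only [lintegral_indicator_one (hE _)]

lemma lintegral_tsum_indicator_sq_le (hE : ∀ i, MeasurableSet (E i))
    (hneg : ∀ i j, i ≠ j → P (E i ∩ E j) ≤ P (E i) * P (E j)) :
    ∫⁻ ω, (∑' i, (E i).indicator 1 ω) ^ 2 ∂P ≤
      ∑' i, P (E i) + (∑' i, P (E i)) ^ 2 := by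
  classical
  have hpair (i j : ι) : MeasurableSet (E i ∩ E j) := (hE i).inter (hE j)
  have hsq (ω : Ω) : (∑' i, (E i).indicator (1 : Ω → ENNReal) ω) ^ 2 =
      ∑' i, ∑' j, (E i ∩ E j).indicator 1 ω := by
    rw [sq, ← ENNReal.tsum_mul_right]
    simp only [← ENNReal.tsum_mul_left, Set.inter_indicator_one, Pi.mul_apply]
  calc ∫⁻ ω, (∑' i, (E i).indicator 1 ω) ^ 2 ∂P
      = ∑' i, ∑' j, P (E i ∩ E j) := by
        simp only [hsq]
        rw [lintegral_tsum fun i => (Measurable.tsum fun j =>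
          measurable_one.indicator (hpair i j)).aemeasurable]
        exact tsum_congr fun i => lintegral_tsum_indicator (hpair i)
    _ ≤ ∑' i, ∑' j, ((if j = i then P (E i) else 0) + P (E i) * P (E j)) := by
        refine ENNReal.tsum_le_tsum fun i => ENNReal.tsum_le_tsum fun j => ?_
        split_ifs with hji
        · exact (measure_mono Set.inter_subset_left).trans le_self_add
        · rw [zero_add]
          exact hneg i j (Ne.symm hji)
    _ = _ := by
        simp_rw [ENNReal.tsum_add, tsum_ite_eq, ENNReal.tsum_mul_left, ENNReal.tsum_mul_right, sq]

lemma measure_le_abs_sub_le [IsProbabilityMeasure P] (hE : ∀ i, MeasurableSet (E i))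
    (hneg : ∀ i j, i ≠ j → P (E i ∩ E j) ≤ P (E i) * P (E j)) {N : Ω → ℕ}
    (hN : ∀ ω, (N ω : ENNReal) = ∑' i, (E i).indicator 1 ω) {m : ℝ}
    (hm : HasSum (fun i => P.real (E i)) m) {t : ℝ} (ht : 0 < t) :
    P {ω | t ≤ |(N ω : ℝ) - m|} ≤ ENNReal.ofReal (m / t ^ 2) := by
  have hm0 : 0 ≤ m := hm.nonneg fun i => measureReal_nonneg
  have hsum : ∑' i, P (E i) = ENNReal.ofReal m := by
    rw [← hm.tsum_eq, ENNReal.ofReal_tsum_of_nonneg (fun i => measureReal_nonneg) hm.summable]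
    exact tsum_congr fun i => (ofReal_measureReal (measure_ne_top P (E i))).symm
  have hmeas : Measurable fun ω => (N ω : ℝ) := by
    have : Measurable fun ω => (N ω : ENNReal) := by
      simp only [hN]
      exact Measurable.tsum fun i => measurable_one.indicator (hE i)
    simpa using this.ennreal_toReal
  have hmean : ∫ ω, (N ω : ℝ) ∂P = m := by
    rw [integral_eq_lintegral_of_nonneg_ae (ae_of_all _ fun ω => by positivity)
      hmeas.aestronglyMeasurable]
    simp only [ENNReal.ofReal_natCast, hN]
    rw [lintegral_tsum_indicator hE, hsum, ENNReal.toReal_ofReal hm0]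
  have hsq : ∫⁻ ω, ENNReal.ofReal ((N ω : ℝ) ^ 2) ∂P ≤ ENNReal.ofReal (m + m ^ 2) := by
    rw [ENNReal.ofReal_add hm0 (by positivity), ENNReal.ofReal_pow hm0, ← hsum]
    simpa [ENNReal.ofReal_pow, hN] using lintegral_tsum_indicator_sq_le hE hneg
  have hL2 : MemLp (fun ω => (N ω : ℝ)) 2 P := by
    rw [memLp_two_iff_integrable_sq hmeas.aestronglyMeasurable]
    refine ⟨(hmeas.pow_const 2).aestronglyMeasurable, ?_⟩
    rw [hasFiniteIntegral_iff_ofReal (ae_of_all _ fun ω => by positivity)]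
    exact hsq.trans_lt ENNReal.ofReal_lt_top
  have hsecond : ∫ ω, (N ω : ℝ) ^ 2 ∂P ≤ m + m ^ 2 := by
    rw [integral_eq_lintegral_of_nonneg_ae (ae_of_all _ fun ω => by positivity)
      (hmeas.pow_const 2).aestronglyMeasurable]
    exact ENNReal.toReal_le_of_le_ofReal (by positivity) hsq
  have hvar : variance (fun ω => (N ω : ℝ)) P ≤ m := by
    rw [variance_eq_sub hL2, hmean]
    simp only [Pi.pow_apply]
    linarith
  calc P {ω | t ≤ |(N ω : ℝ) - m|}
      ≤ ENNReal.ofReal (variance (fun ω => (N ω : ℝ)) P / t ^ 2) :=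
        hmean ▸ meas_ge_le_variance_div_sq hL2 ht
    _ ≤ ENNReal.ofReal (m / t ^ 2) := by gcongr

lemma measure_inter_le_mul_of_compl {A B : Set Ω} [IsProbabilityMeasure P]
    (hA : MeasurableSet A) (hB : MeasurableSet B)
    (h : P.real (Aᶜ ∩ Bᶜ) ≤ P.real Aᶜ * P.real Bᶜ) : P (A ∩ B) ≤ P A * P B := by
  have hunion := measureReal_union_add_inter (μ := P) (s := A) hB
  rw [← Set.compl_union, probReal_compl_eq_one_sub (hA.union hB), probReal_compl_eq_one_sub hA,
    probReal_compl_eq_one_sub hB] at h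
  have hreal : P.real (A ∩ B) ≤ P.real A * P.real B := by linarith
  rw [← ofReal_measureReal (μ := P) (s := A), ← ofReal_measureReal (μ := P) (s := B),
    ← ENNReal.ofReal_mul measureReal_nonneg, ← ofReal_measureReal (μ := P) (s := A ∩ B)]
  exact ENNReal.ofReal_le_ofReal hreal

end NegativelyCorrelatedEvents

/-- The event that the word `i` is among the first `k` words. -/
def occurs {Ω α : Type*} (X : ℕ → Ω → α) (k : ℕ) (i : α) : Set Ω :=
  ⋃ l ∈ Finset.range k, X l ⁻¹' {i}

lemma numDistinct_eq_tsum {Ω : Type*} (X : ℕ → Ω → ℕ) (k : ℕ) (ω : Ω) :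
    (numDistinct (fun j => X j ω) k : ENNReal) =
      ∑' i, (occurs X k i).indicator 1 ω := by
  have hmem (i : ℕ) : i ∈ (Finset.range k).image (fun j => X j ω) ↔ ω ∈ occurs X k i := by
    simp [occurs]
  rw [tsum_eq_sum (s := (Finset.range k).image fun j => X j ω) fun i hi =>
    Set.indicator_of_notMem (mt (hmem i).2 hi) _,
    Finset.sum_congr rfl fun i hi => Set.indicator_of_mem ((hmem i).1 hi) _]
  simp [numDistinct]

section Occurs

variable {Ω α : Type*} [MeasurableSpace Ω] [MeasurableSpace α] {P : Measure Ω} {X : ℕ → Ω → α}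
  {p : α → ℝ}

lemma measureReal_iInter_preimage (hind : iIndepFun X P) {S : Set α} (hS : MeasurableSet S)
    {s : ℝ} (hs : ∀ l, P.real (X l ⁻¹' S) = s) (k : ℕ) :
    P.real (⋂ l ∈ Finset.range k, X l ⁻¹' S) = s ^ k := by
  rw [Measure.real, hind.measure_inter_preimage_eq_mul (Finset.range k) (sets := fun _ => S)
    fun l _ => hS, ENNReal.toReal_prod]
  simp only [← measureReal_def, hs, Finset.prod_const, Finset.card_range]

variable [MeasurableSingletonClass α]

lemma measurableSet_occurs (hX : ∀ l, Measurable (X l)) (k : ℕ) (i : α) :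
    MeasurableSet (occurs X k i) :=
  Finset.measurableSet_biUnion _ fun l _ => hX l (measurableSet_singleton i)

variable [IsProbabilityMeasure P]

lemma measureReal_occurs_compl (hX : ∀ l, Measurable (X l)) (hind : iIndepFun X P)
    (hp : ∀ l i, P.real (X l ⁻¹' {i}) = p i) (k : ℕ) (i : α) :
    P.real (occurs X k i)ᶜ = (1 - p i) ^ k := by
  rw [← measureReal_iInter_preimage hind (measurableSet_singleton i).compl (fun l => by
    rw [Set.preimage_compl, probReal_compl_eq_one_sub (hX l (measurableSet_singleton i)), hp])]
  simp only [occurs, Set.compl_iUnion, Set.preimage_compl]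

lemma measureReal_occurs (hX : ∀ l, Measurable (X l)) (hind : iIndepFun X P)
    (hp : ∀ l i, P.real (X l ⁻¹' {i}) = p i) (k : ℕ) (i : α) :
    P.real (occurs X k i) = 1 - (1 - p i) ^ k := by
  rw [← measureReal_occurs_compl hX hind hp,
    probReal_compl_eq_one_sub (measurableSet_occurs hX k i), sub_sub_cancel]

lemma measureReal_preimage_pair (hX : ∀ l, Measurable (X l))
    (hp : ∀ l i, P.real (X l ⁻¹' {i}) = p i) {i j : α} (hij : i ≠ j) (l : ℕ) :
    P.real (X l ⁻¹' {i, j}) = p i + p j := by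
  rw [← hp l i, ← hp l j, ← measureReal_union ((Set.disjoint_singleton.2 hij).preimage _)
    (hX l (measurableSet_singleton j)), ← Set.preimage_union, Set.singleton_union]

lemma measureReal_occurs_compl_inter_compl (hX : ∀ l, Measurable (X l)) (hind : iIndepFun X P)
    (hp : ∀ l i, P.real (X l ⁻¹' {i}) = p i) (k : ℕ) {i j : α} (hij : i ≠ j) :
    P.real ((occurs X k i)ᶜ ∩ (occurs X k j)ᶜ) = (1 - (p i + p j)) ^ k := by
  have hpair : MeasurableSet ({i, j} : Set α) := (measurableSet_singleton j).insert i
  rw [← measureReal_iInter_preimage hind hpair.compl (fun l => by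
    rw [Set.preimage_compl, probReal_compl_eq_one_sub (hX l hpair),
      measureReal_preimage_pair hX hp hij])]
  simp only [occurs, ← Set.singleton_union, Set.compl_iUnion, Set.compl_union, Set.preimage_inter,
    Set.preimage_compl, Set.iInter_inter_distrib]

lemma measure_occurs_inter_le (hX : ∀ l, Measurable (X l)) (hind : iIndepFun X P)
    (hp : ∀ l i, P.real (X l ⁻¹' {i}) = p i) (k : ℕ) {i j : α} (hij : i ≠ j) :
    P (occurs X k i ∩ occurs X k j) ≤ P (occurs X k i) * P (occurs X k j) := by
  have hi : 0 ≤ p i := hp 0 i ▸ measureReal_nonneg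
  have hj : 0 ≤ p j := hp 0 j ▸ measureReal_nonneg
  have hle : p i + p j ≤ 1 := measureReal_preimage_pair hX hp hij 0 ▸ measureReal_le_one
  refine measure_inter_le_mul_of_compl (measurableSet_occurs hX k i) (measurableSet_occurs hX k j)
    ?_
  rw [measureReal_occurs_compl_inter_compl hX hind hp k hij, measureReal_occurs_compl hX hind hp,
    measureReal_occurs_compl hX hind hp, ← mul_pow]
  exact pow_le_pow_left₀ (by linarith) (by linarith [mul_nonneg hi hj]) k

end Occurs

lemma hasSum_measureReal_preimage_singleton {Ω α : Type*} [MeasurableSpace Ω] [MeasurableSpace α]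
    [MeasurableSingletonClass α] [Countable α] (P : Measure Ω) [IsProbabilityMeasure P] {Y : Ω → α}
    (hY : Measurable Y) : HasSum (fun i => P.real (Y ⁻¹' {i})) 1 := by
  have htotal := tsum_measure_preimage_singleton (μ := P) (f := Y) Set.countable_univ
    fun i _ => hY (measurableSet_singleton i)
  rw [tsum_univ fun i => P (Y ⁻¹' {i}), Set.preimage_univ, measure_univ] at htotal
  have := ENNReal.hasSum_toReal (f := fun i => P (Y ⁻¹' {i})) (htotal ▸ ENNReal.one_ne_top)
  rwa [← ENNReal.tsum_toReal_eq fun _ => measure_ne_top _ _, htotal, ENNReal.toReal_one] at this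

section IsZMText

variable {Ω : Type*} [MeasurableSpace Ω] {P : Measure Ω} {X : ℕ → Ω → ℕ} {θ q : ℝ}

lemma IsZMText.measureReal_succ (h : IsZMText P X θ q) (h0 : 0 < θ) (h1 : θ < 1) (hq : -1 < q)
    (l i : ℕ) : P.real (X l ⁻¹' {i + 1}) = zmProb θ q (i + 1) := by
  have hlaw : P (X l ⁻¹' {i + 1}) = _ := h.law l (i + 1) (by omega)
  rw [Measure.real, hlaw, ENNReal.toReal_ofReal (zmProb_pos h0 h1 hq i).le]

lemma IsZMText.measureReal_zero (h : IsZMText P X θ q) (h0 : 0 < θ) (h1 : θ < 1) (hq : -1 < q)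
    (l : ℕ) : P.real (X l ⁻¹' {0}) = 0 := by
  have := h.prob
  have htail := (hasSum_nat_add_iff' 1).2 (hasSum_measureReal_preimage_singleton P (h.meas l))
  simp only [h.measureReal_succ h0 h1 hq, Finset.sum_range_one] at htail
  linarith [htail.unique (hasSum_zmProb h0 h1 hq)]

lemma IsZMText.measure_deviation_le (h : IsZMText P X θ q) (h0 : 0 < θ) (h1 : θ < 1) (hq : -1 < q)
    (k : ℕ) {t : ℝ} (ht : 0 < t) :
    P {ω | t ≤ |(numDistinct (fun j => X j ω) k : ℝ) - meanDistinct θ q k|} ≤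
      ENNReal.ofReal (meanDistinct θ q k / t ^ 2) := by
  have := h.prob
  have hp (l i : ℕ) : P.real (X l ⁻¹' {i}) = if i = 0 then 0 else zmProb θ q i := by
    cases i with
    | zero => simpa using h.measureReal_zero h0 h1 hq l
    | succ i => simpa using h.measureReal_succ h0 h1 hq l i
  refine measure_le_abs_sub_le (measurableSet_occurs h.meas k)
    (fun i j => measure_occurs_inter_le h.meas h.indep hp k) (numDistinct_eq_tsum X k) ?_ ht
  simp only [measureReal_occurs h.meas h.indep hp]
  rw [← hasSum_nat_add_iff' 1]
  simpa [meanDistinct] using (summable_meanDistinct h0 h1 hq k).hasSum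

end IsZMText

/-- The jump `A(x+) - A(x-)`, that is, the atom of `dA` at `x`. -/
def jump (A : ℝ → ℝ) (x : ℝ) : ℝ := Function.rightLim A x - Function.leftLim A x

/-- `A` is piecewise `C¹` on `[x, y]`, possibly with jumps at the points of `G`: on an open interval
without points of `G` it agrees with a function that is `C¹` up to the end points. -/
def IsPiecewiseC1Off (A : ℝ → ℝ) (G : Finset ℝ) (x y : ℝ) : Prop :=
  ∀ u v, x ≤ u → u < v → v ≤ y → (∀ z ∈ G, z ∉ Set.Ioo u v) →
    ∃ g : ℝ → ℝ, ContDiffOn ℝ 1 g (Set.Icc u v) ∧ Set.EqOn A g (Set.Ioo u v)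

lemma jump_eq_zero_of_continuousAt {A : ℝ → ℝ} {x : ℝ} (h : ContinuousAt A x) : jump A x = 0 := by
  rw [jump, h.continuousWithinAt.leftLim_eq, h.continuousWithinAt.rightLim_eq, sub_self]

lemma leftLim_eq_of_eqOn_Ioo {A g : ℝ → ℝ} {u v : ℝ} (huv : u < v)
    (hg : ContinuousOn g (Set.Icc u v)) (hA : Set.EqOn A g (Set.Ioo u v)) :
    Function.leftLim A v = g v := by
  refine leftLim_eq_of_tendsto (Tendsto.congr' ?_ ((hg v (Set.right_mem_Icc.2 huv.le)).mono_left
    (nhdsWithin_le_of_mem (mem_of_superset (Ioo_mem_nhdsLT huv) Set.Ioo_subset_Icc_self))))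
  filter_upwards [Ioo_mem_nhdsLT huv] with t ht using (hA ht).symm

lemma rightLim_eq_of_eqOn_Ioo {A g : ℝ → ℝ} {u v : ℝ} (huv : u < v)
    (hg : ContinuousOn g (Set.Icc u v)) (hA : Set.EqOn A g (Set.Ioo u v)) :
    Function.rightLim A u = g u := by
  refine rightLim_eq_of_tendsto (Tendsto.congr' ?_ ((hg u (Set.left_mem_Icc.2 huv.le)).mono_left
    (nhdsWithin_le_of_mem (mem_of_superset (Ioo_mem_nhdsGT huv) Set.Ioo_subset_Icc_self))))
  filter_upwards [Ioo_mem_nhdsGT huv] with t ht using (hA ht).symm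

lemma integral_deriv_of_eqOn_Ioo {A g : ℝ → ℝ} {u v : ℝ} (huv : u < v)
    (hg : ContDiffOn ℝ 1 g (Set.Icc u v)) (hA : Set.EqOn A g (Set.Ioo u v)) :
    IntervalIntegrable (deriv A) volume u v ∧
      ∫ t in u..v, deriv A t = Function.leftLim A v - Function.rightLim A u := by
  have hderiv (t : ℝ) (ht : t ∈ Set.Ioo u v) :
      HasDerivAt A (derivWithin g (Set.Icc u v) t) t :=
    (((hg.differentiableOn one_ne_zero) t (Set.Ioo_subset_Icc_self ht)).hasDerivWithinAt.hasDerivAt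
      (Icc_mem_nhds ht.1 ht.2)).congr_of_eventuallyEq
      (hA.eventuallyEq_of_mem (Ioo_mem_nhds ht.1 ht.2))
  have hint : IntervalIntegrable (deriv A) volume u v := by
    refine (intervalIntegrable_iff_integrableOn_Ioo_of_le huv.le).2 (IntegrableOn.congr_fun
      (f := derivWithin g (Set.Icc u v)) ?_ (fun t ht => (hderiv t ht).deriv.symm)
      measurableSet_Ioo)
    exact (hg.continuousOn_derivWithin (uniqueDiffOn_Icc huv) le_rfl).integrableOn_Icc.mono_set
      Set.Ioo_subset_Icc_self
  refine ⟨hint, ?_⟩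
  rw [leftLim_eq_of_eqOn_Ioo huv hg.continuousOn hA, rightLim_eq_of_eqOn_Ioo huv hg.continuousOn hA]
  refine intervalIntegral.integral_eq_sub_of_hasDerivAt_of_le huv.le hg.continuousOn
    (fun t ht => ?_) hint
  exact (hderiv t ht).differentiableAt.hasDerivAt.congr_of_eventuallyEq
    (hA.symm.eventuallyEq_of_mem (Ioo_mem_nhds ht.1 ht.2))

lemma IsPiecewiseC1Off.continuousAt {A : ℝ → ℝ} {G : Finset ℝ} {x y t : ℝ}
    (h : IsPiecewiseC1Off A G x y) (ht : t ∈ Set.Ioo x y) (htG : t ∉ G) : ContinuousAt A t := by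
  obtain ⟨u, v, htuv, hsub⟩ := mem_nhds_iff_exists_Ioo_subset.1 (inter_mem
    (Ioo_mem_nhds ht.1 ht.2) (G.finite_toSet.isClosed.isOpen_compl.mem_nhds htG))
  have huv := htuv.1.trans htuv.2
  have hxy := (Set.Ioo_subset_Ioo_iff huv).1 (hsub.trans Set.inter_subset_left)
  obtain ⟨g, hg, hA⟩ := h u v hxy.1 huv hxy.2 fun z hz hzuv => (hsub hzuv).2 hz
  exact (hg.continuousOn.continuousAt (Icc_mem_nhds htuv.1 htuv.2)).congr
    (hA.symm.eventuallyEq_of_mem (Ioo_mem_nhds htuv.1 htuv.2))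

lemma IsPiecewiseC1Off.sum_jump_add_integral_deriv {A : ℝ → ℝ} {G : Finset ℝ} {x y : ℝ}
    (hxy : x < y) (hG : ∀ z ∈ G, z ∈ Set.Ioo x y) (h : IsPiecewiseC1Off A G x y) :
    IntervalIntegrable (deriv A) volume x y ∧
      (∑ z ∈ G, jump A z) + ∫ t in x..y, deriv A t =
        Function.leftLim A y - Function.rightLim A x := by
  induction G using Finset.induction_on_max generalizing y with
  | empty =>
    obtain ⟨g, hg, hA⟩ := h x y le_rfl hxy le_rfl (by simp)
    rw [Finset.sum_empty, zero_add]
    exact integral_deriv_of_eqOn_Ioo hxy hg hA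
  | insert m G hm ih =>
    obtain ⟨hxm, hmy⟩ := hG m (Finset.mem_insert_self m G)
    obtain ⟨hint, hsum⟩ := ih hxm
      (fun z hz => ⟨(hG z (Finset.mem_insert_of_mem hz)).1, hm z hz⟩)
      fun u v hu huv hv hz => h u v hu huv (hv.trans hmy.le) <| by
        simpa only [Finset.forall_mem_insert] using ⟨fun hmem => hmem.2.not_ge hv, hz⟩
    obtain ⟨g, hg, hA⟩ := h m y hxm.le hmy le_rfl <| by
      simpa only [Finset.forall_mem_insert] using
        ⟨fun hmem => hmem.1.false, fun z hz hmem => hmem.1.not_gt (hm z hz)⟩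
    obtain ⟨hint', hsum'⟩ := integral_deriv_of_eqOn_Ioo hmy hg hA
    refine ⟨hint.trans hint', ?_⟩
    rw [Finset.sum_insert fun hmem => (hm m hmem).false,
      ← intervalIntegral.integral_add_adjacent_intervals hint hint', hsum', jump]
    linear_combination hsum

lemma IsStepFun.exists_eqOn_const {S : ℝ → ℝ} (hS : IsStepFun S) :
    ∃ F : Finset ℝ, ∀ u v, 0 ≤ u → u < v → v ≤ 1 → (∀ z ∈ F, z ∉ Set.Ioo u v) →
      ∃ c, ∀ t ∈ Set.Ioo u v, S t = c := by
  obtain ⟨F, hF⟩ := hS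
  refine ⟨F, fun u v hu huv hv hz => ?_⟩
  have hle {s t : ℝ} (hs : s ∈ Set.Ioo u v) (ht : t ∈ Set.Ioo u v) (hst : s ≤ t) : S s = S t :=
    hF s t (hu.trans hs.1.le) hst (ht.2.le.trans hv) fun z hzF hzst =>
      hz z hzF ⟨hs.1.trans_le hzst.1, hzst.2.trans_lt ht.2⟩
  obtain ⟨c, hc⟩ := exists_between huv
  refine ⟨S c, fun t ht => ?_⟩
  rcases le_total t c with h | h
  exacts [hle ht hc h, (hle hc ht h).symm]

lemma IsWeight.exists_isPiecewiseC1Off {A : ℝ → ℝ} (hA : IsWeight A) :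
    ∃ G : Finset ℝ, (∀ z ∈ G, z ∈ Set.Ioo (0 : ℝ) 1) ∧ IsPiecewiseC1Off A G 0 1 := by
  classical
  obtain ⟨S, B, hS, ⟨-, F', hF'⟩, hAeq⟩ := hA.regular
  obtain ⟨F, hF⟩ := hS.exists_eqOn_const
  refine ⟨(F ∪ F').filter (· ∈ Set.Ioo (0 : ℝ) 1), fun z hz => (Finset.mem_filter.1 hz).2,
    fun u v hu huv hv hz => ?_⟩
  have hmem (z : ℝ) (hzF : z ∈ F ∪ F') (hzuv : z ∈ Set.Ioo u v) : False :=
    hz z (Finset.mem_filter.2 ⟨hzF, hu.trans_lt hzuv.1, hzuv.2.trans_le hv⟩) hzuv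
  obtain ⟨c, hc⟩ := hF u v hu huv hv fun z hz => hmem z (Finset.mem_union_left _ hz)
  refine ⟨fun t => c + B t, contDiffOn_const.add
    (hF' u v hu huv hv fun z hz => hmem z (Finset.mem_union_right _ hz)), fun t ht => ?_⟩
  rw [hAeq t ⟨hu.trans ht.1.le, ht.2.le.trans hv⟩, hc t ht]

/-- `dA` is a finite signed measure on `[δ, 1]`: finitely many atoms, all of them in `G`, and an
absolutely continuous part. -/
structure HasFiniteVariation (A : ℝ → ℝ) (δ : ℝ) (G : Finset ℝ) : Prop where
  subset_Icc : ∀ x ∈ G, x ∈ Set.Icc δ 1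
  jump_eq_zero : ∀ x ∉ G, jump A x = 0
  deriv_eq_zero : ∀ x < δ, deriv A x = 0
  intervalIntegrable : IntervalIntegrable (deriv A) volume 0 1

namespace HasFiniteVariation

variable {A : ℝ → ℝ} {δ : ℝ} {G : Finset ℝ}

lemma stieltjesIntegral_eq (h : HasFiniteVariation A δ G) (f : ℝ → ℝ) :
    stieltjesIntegral f A = (∑ x ∈ G, f x * jump A x) + ∫ t in (0 : ℝ)..1, f t * deriv A t := by
  refine congrArg (· + _) (finsum_eq_finsetSum_of_support_subset _ fun x hx => ?_)
  by_contra hxG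
  exact hx (mul_eq_zero_of_right _ (h.jump_eq_zero x hxG))

lemma abs_mul_deriv_le (h : HasFiniteVariation A δ G) {f : ℝ → ℝ} {M : ℝ}
    (hM : ∀ t ∈ Set.Icc δ 1, |f t| ≤ M) {t : ℝ} (ht : t ≤ 1) :
    |f t * deriv A t| ≤ M * |deriv A t| := by
  rcases lt_or_ge t δ with hδ | hδ
  · simp only [h.deriv_eq_zero t hδ, mul_zero, abs_zero, le_refl]
  · rw [abs_mul]
    exact mul_le_mul_of_nonneg_right (hM t ⟨hδ, ht⟩) (abs_nonneg _)

lemma intervalIntegrable_mul (h : HasFiniteVariation A δ G) {f : ℝ → ℝ} {M : ℝ}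
    (hf : Measurable f) (hM : ∀ t ∈ Set.Icc δ 1, |f t| ≤ M) :
    IntervalIntegrable (fun t => f t * deriv A t) volume 0 1 := by
  refine (h.intervalIntegrable.abs.const_mul M).mono_fun'
    (hf.mul (measurable_deriv A)).aestronglyMeasurable
    ((ae_restrict_iff' measurableSet_uIoc).2 (Eventually.of_forall fun t ht => ?_))
  rw [Set.uIoc_of_le zero_le_one] at ht
  exact h.abs_mul_deriv_le hM ht.2

lemma stieltjesIntegral_add (h : HasFiniteVariation A δ G) {f g : ℝ → ℝ} {M N : ℝ}
    (hf : Measurable f) (hM : ∀ t ∈ Set.Icc δ 1, |f t| ≤ M)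
    (hg : Measurable g) (hN : ∀ t ∈ Set.Icc δ 1, |g t| ≤ N) :
    stieltjesIntegral (fun t => f t + g t) A = stieltjesIntegral f A + stieltjesIntegral g A := by
  simp only [h.stieltjesIntegral_eq, add_mul, Finset.sum_add_distrib]
  rw [intervalIntegral.integral_add (h.intervalIntegrable_mul hf hM)
    (h.intervalIntegrable_mul hg hN)]
  ring

lemma stieltjesIntegral_const_mul (h : HasFiniteVariation A δ G) (c : ℝ) (f : ℝ → ℝ) :
    stieltjesIntegral (fun t => c * f t) A = c * stieltjesIntegral f A := by
  simp only [h.stieltjesIntegral_eq, mul_assoc, intervalIntegral.integral_const_mul, mul_add,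
    Finset.mul_sum]

lemma abs_stieltjesIntegral_le (h : HasFiniteVariation A δ G) {f : ℝ → ℝ} {η : ℝ}
    (hη : ∀ t ∈ Set.Icc δ 1, |f t| ≤ η) :
    |stieltjesIntegral f A| ≤ η * (∑ x ∈ G, |jump A x| + ∫ t in (0 : ℝ)..1, |deriv A t|) := by
  rw [h.stieltjesIntegral_eq, mul_add, Finset.mul_sum, ← intervalIntegral.integral_const_mul]
  refine (abs_add_le _ _).trans (add_le_add ((Finset.abs_sum_le_sum_abs _ _).trans
    (Finset.sum_le_sum fun x hx => ?_)) ?_)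
  · rw [abs_mul]
    exact mul_le_mul_of_nonneg_right (hη x (h.subset_Icc x hx)) (abs_nonneg _)
  · refine intervalIntegral.norm_integral_le_of_norm_le (E := ℝ) zero_le_one
      (Eventually.of_forall fun t ht => ?_) (h.intervalIntegrable.abs.const_mul η)
    exact h.abs_mul_deriv_le hη ht.2

end HasFiniteVariation

lemma IsWeight.exists_hasFiniteVariation {A : ℝ → ℝ} (hA : IsWeight A) :
    ∃ δ G, 0 < δ ∧ δ < 1 ∧ HasFiniteVariation A δ G ∧ stieltjesIntegral (fun _ => 1) A = 0 := by
  classical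
  obtain ⟨δ, hδ0, hδ1, hδ⟩ := hA.zero_left
  obtain ⟨G, hG, hAG⟩ := hA.exists_isPiecewiseC1Off
  have hleft (x : ℝ) (hx : x < δ) : A =ᶠ[𝓝 x] fun _ => 0 := by
    filter_upwards [Iio_mem_nhds hx] with t ht using hδ t (le_of_lt ht)
  have hright (x : ℝ) (hx : 1 < x) : A =ᶠ[𝓝 x] fun _ => 0 := by
    filter_upwards [Ioi_mem_nhds hx] with t ht using hA.zero_right t (le_of_lt ht)
  have hjump (x : ℝ) (hx : A =ᶠ[𝓝 x] fun _ => 0) : jump A x = 0 :=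
    jump_eq_zero_of_continuousAt (continuousAt_const.congr hx.symm)
  have hjump_off (x : ℝ) (hx : x ∉ insert 1 G) : jump A x = 0 := by
    rw [Finset.mem_insert, not_or] at hx
    rcases lt_or_ge x δ with h | h
    · exact hjump x (hleft x h)
    rcases lt_or_gt_of_ne hx.1 with h' | h'
    · exact jump_eq_zero_of_continuousAt (hAG.continuousAt ⟨hδ0.trans_le h, h'⟩ hx.2)
    · exact hjump x (hright x h')
  obtain ⟨hint, hsum⟩ := hAG.sum_jump_add_integral_deriv zero_lt_one hG
  have hvar : HasFiniteVariation A δ ((insert 1 G).filter (δ ≤ ·)) := by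
    refine ⟨fun x hx => ?_, fun x hx => ?_, fun x hx => (hleft x hx).deriv_eq.trans
      (deriv_const x 0), hint⟩
    · obtain ⟨hxG, hxδ⟩ := Finset.mem_filter.1 hx
      exact ⟨hxδ, (Finset.mem_insert.1 hxG).elim le_of_eq fun h => (hG x h).2.le⟩
    · rcases not_and_or.1 (mt Finset.mem_filter.2 hx) with h | h
      exacts [hjump_off x h, hjump x (hleft x (not_le.1 h))]
  refine ⟨δ, _, hδ0, hδ1, hvar, ?_⟩
  have hrightLim_one : Function.rightLim A 1 = 0 := rightLim_eq_of_tendsto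
    (tendsto_const_nhds.congr' (eventually_nhdsWithin_of_forall fun t ht =>
      (hA.zero_right t (le_of_lt ht)).symm))
  have hrightLim_zero : Function.rightLim A 0 = 0 := rightLim_eq_of_tendsto
    (tendsto_const_nhds.congr' ((hleft 0 hδ0).symm.filter_mono nhdsWithin_le_nhds))
  simp only [hvar.stieltjesIntegral_eq, one_mul]
  rw [Finset.sum_filter_of_ne fun x _ hx => not_lt.1 fun h => hx (hjump x (hleft x h)),
    Finset.sum_insert fun h => (hG 1 h).2.false, jump, hrightLim_one]
  linear_combination hsum - hrightLim_zero

/-- Since `∫ dA = 0` and `∫ log t dA(t) = 1`, the integral `∫ f dA` recovers the slope of `f` as a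
function of `log t`. -/
lemma IsWeight.exists_abs_stieltjesIntegral_sub_le {A : ℝ → ℝ} (hA : IsWeight A) :
    ∃ δ V : ℝ, 0 < δ ∧ δ < 1 ∧ ∀ (f : ℝ → ℝ) (κ θ η : ℝ), Measurable f →
      (∀ t ∈ Set.Icc δ 1, |f t - (κ + θ * Real.log t)| ≤ η) →
      |stieltjesIntegral f A - θ| ≤ η * V := by
  obtain ⟨δ, G, hδ0, hδ1, h, hmass⟩ := hA.exists_hasFiniteVariation
  refine ⟨δ, ∑ x ∈ G, |jump A x| + ∫ t in (0 : ℝ)..1, |deriv A t|, hδ0, hδ1,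
    fun f κ θ η hf hη => ?_⟩
  have hlog (t : ℝ) (ht : t ∈ Set.Icc δ 1) : |θ * Real.log t| ≤ |θ| * -Real.log δ := by
    rw [abs_mul, abs_of_nonpos (Real.log_nonpos (hδ0.le.trans ht.1) ht.2)]
    exact mul_le_mul_of_nonneg_left (neg_le_neg (Real.log_le_log hδ0 ht.1)) (abs_nonneg θ)
  have hlog_meas : Measurable fun t => θ * Real.log t := Real.measurable_log.const_mul θ
  have hline : stieltjesIntegral (fun t => κ * 1 + θ * Real.log t) A = θ := by
    rw [h.stieltjesIntegral_add measurable_const (fun _ _ => le_rfl) hlog_meas hlog,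
      h.stieltjesIntegral_const_mul κ, h.stieltjesIntegral_const_mul θ, hmass, hA.integral_log]
    ring
  have hsplit : stieltjesIntegral f A = stieltjesIntegral (fun t => f t - (κ + θ * Real.log t)) A +
      stieltjesIntegral (fun t => κ * 1 + θ * Real.log t) A := by
    rw [← h.stieltjesIntegral_add (f := fun t => f t - (κ + θ * Real.log t))
      (hf.sub (hlog_meas.const_add κ)) hη (hlog_meas.const_add (κ * 1)) fun t ht =>
        (abs_add_le _ _).trans (add_le_add_right (hlog t ht) _)]
    simp only [mul_one, sub_add_cancel]
  rw [hsplit, hline, add_sub_cancel_right]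
  exact h.abs_stieltjesIntegral_le hη

lemma abs_log_le_two_mul_abs_sub_one {x : ℝ} (hx : |x - 1| ≤ 1 / 2) :
    |Real.log x| ≤ 2 * |x - 1| := by
  have hx' : |1 - x| ≤ 1 / 2 := by rwa [abs_sub_comm]
  have h := Real.abs_log_sub_add_sum_range_le (x := 1 - x) (by linarith) 0
  rw [Finset.sum_range_zero, zero_add, sub_sub_cancel, zero_add, pow_one, abs_sub_comm] at h
  refine h.trans ?_
  rw [div_le_iff₀ (by linarith), mul_right_comm]
  exact le_mul_of_one_le_left (abs_nonneg _) (by linarith)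

lemma log_add_one_sub_log_le {x : ℝ} (hx : 0 < x) : Real.log (x + 1) - Real.log x ≤ 1 / x := by
  rw [← Real.log_div (by positivity) hx.ne']
  refine (Real.log_le_sub_one_of_pos (by positivity)).trans_eq ?_
  field_simp
  ring

lemma inv_nthRoot_le {L k : ℕ} (hL : L ≠ 0) (hk : 1 ≤ k) :
    ((L.nthRoot k : ℕ) : ℝ)⁻¹ ≤ 2 * (k : ℝ) ^ (-(1 / (L : ℝ))) := by
  set m := L.nthRoot k
  have hkm : k < (m + 1) ^ L := Nat.lt_pow_nthRoot_add_one hL k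
  have hm : (1 : ℝ) ≤ m := by
    exact_mod_cast Nat.lt_succ_iff.1 (lt_of_pow_lt_pow_left₀ L (Nat.zero_le _)
      ((one_pow L).trans_le hk |>.trans_lt hkm))
  have hk0 : (0 : ℝ) < k := by exact_mod_cast hk
  have hroot : (k : ℝ) ^ (1 / (L : ℝ)) ≤ m + 1 := by
    rw [one_div, Real.rpow_inv_le_iff_of_pos hk0.le (by positivity) (by positivity),
      Real.rpow_natCast]
    exact_mod_cast hkm.le
  rw [Real.rpow_neg hk0.le, ← div_eq_mul_inv, inv_eq_one_div,
    div_le_div_iff₀ (by linarith) (by positivity)]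
  linarith

lemma abs_sub_le_of_monotone_of_pow {g : ℕ → ℝ} (hg : Monotone g) {κ θ E : ℝ} (hθ : 0 ≤ θ)
    (hE : 0 ≤ E) {L M : ℕ} (hL : L ≠ 0) (hM : 1 ≤ M)
    (h : ∀ m ≥ M, |g (m ^ L) - (κ + θ * Real.log ((m ^ L : ℕ) : ℝ))| ≤ E / m) :
    ∀ k ≥ M ^ L, |g k - (κ + θ * Real.log k)| ≤ 2 * (E + θ * L) * (k : ℝ) ^ (-(1 / (L : ℝ))) := by
  intro k hk
  have hk1 : 1 ≤ k := (Nat.one_le_pow L M hM).trans hk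
  have hroot := inv_nthRoot_le hL hk1
  set m := L.nthRoot k
  have hmk : m ^ L ≤ k := Nat.pow_nthRoot_le (.inl hL)
  have hkm : k < (m + 1) ^ L := Nat.lt_pow_nthRoot_add_one hL k
  have hMm : M ≤ m := Nat.lt_succ_iff.1 (lt_of_pow_lt_pow_left₀ L (Nat.zero_le _) (hk.trans_lt hkm))
  have hm0 : (0 : ℝ) < m := by exact_mod_cast hM.trans hMm
  have hlow := abs_le.1 (h m hMm)
  have hupp := abs_le.1 ((h (m + 1) (by omega)).trans
    (div_le_div_of_nonneg_left hE hm0 (by push_cast; linarith)))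
  have hlog_low : Real.log ((m ^ L : ℕ) : ℝ) ≤ Real.log k :=
    Real.log_le_log (by exact_mod_cast Nat.one_le_pow L m (hM.trans hMm)) (by exact_mod_cast hmk)
  have hlog_upp : Real.log k ≤ Real.log (((m + 1) ^ L : ℕ) : ℝ) :=
    Real.log_le_log (by exact_mod_cast hk1) (by exact_mod_cast hkm.le)
  have hlog_gap : θ * (Real.log (((m + 1) ^ L : ℕ) : ℝ) - Real.log ((m ^ L : ℕ) : ℝ)) ≤
      θ * L / m := by
    have := mul_le_mul_of_nonneg_left (log_add_one_sub_log_le hm0)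
      (mul_nonneg hθ L.cast_nonneg)
    push_cast [Real.log_pow]
    calc _ = θ * L * (Real.log (m + 1) - Real.log m) := by ring
      _ ≤ θ * L / m := by simpa only [mul_one_div] using this
  calc |g k - (κ + θ * Real.log k)| ≤ (E + θ * L) / m := by
        have := hg hmk
        have := hg hkm.le
        have := mul_le_mul_of_nonneg_left hlog_low hθ
        have := mul_le_mul_of_nonneg_left hlog_upp hθ
        rw [add_div, abs_le]
        constructor <;> linarith
    _ ≤ (E + θ * L) * (2 * (k : ℝ) ^ (-(1 / (L : ℝ)))) := by
        rw [div_eq_mul_inv]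
        gcongr
    _ = 2 * (E + θ * L) * (k : ℝ) ^ (-(1 / (L : ℝ))) := by ring

lemma numDistinct_mono (w : ℕ → ℕ) : Monotone (numDistinct w) := fun _ _ h =>
  Finset.card_le_card (Finset.image_subset_image (Finset.range_subset_range.2 h))

lemma numDistinct_pos (w : ℕ → ℕ) {k : ℕ} (hk : k ≠ 0) : 0 < numDistinct w k :=
  Finset.card_pos.2 ((Finset.nonempty_range_iff.2 hk).image w)

lemma monotone_log_numDistinct (w : ℕ → ℕ) : Monotone fun k => Real.log (numDistinct w k) := by
  intro k l hkl
  simp only [← Real.log_of_nat_eq_posLog]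
  exact Real.posLog_le_posLog (Nat.cast_nonneg _) (by exact_mod_cast numDistinct_mono w hkl)

/-- From time `M ^ L` on, the number of different words of the text `w` is close to its mean along
the `L`-th powers. -/
def FollowsMean (θ q : ℝ) (L M : ℕ) (w : ℕ → ℕ) : Prop :=
  ∀ m ≥ M, |(numDistinct w (m ^ L) : ℝ) - meanDistinct θ q (m ^ L)| ≤ ((m ^ L : ℕ) : ℝ) ^ θ / m

lemma natCast_pow_rpow {m L : ℕ} {θ : ℝ} : ((m ^ L : ℕ) : ℝ) ^ θ = (m : ℝ) ^ (L * θ) := by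
  rw [Nat.cast_pow, ← Real.rpow_natCast, ← Real.rpow_mul m.cast_nonneg]

lemma FollowsMean.abs_log_sub_le {θ q : ℝ} (h0 : 0 < θ) (h1 : θ < 1) (hq : -1 < q) {L M : ℕ}
    (hL : 1 ≤ L * θ) {w : ℕ → ℕ} (hw : FollowsMean θ q L M w)
    (hM : 2 * ((q + 4) / growthCoeff θ q) ≤ M) {m : ℕ} (hm : M ≤ m) :
    |Real.log (numDistinct w (m ^ L)) - (Real.log (growthCoeff θ q) +
      θ * Real.log ((m ^ L : ℕ) : ℝ))| ≤ 2 * ((q + 4) / growthCoeff θ q) / m := by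
  have hD := growthCoeff_pos h0 h1 hq
  set D := growthCoeff θ q
  have hm0 : (0 : ℝ) < m := by
    have hmM : (M : ℝ) ≤ m := by exact_mod_cast hm
    have : 0 < (q + 4) / D := div_pos (by linarith) hD
    linarith
  have hmL : (0 : ℝ) < (m ^ L : ℕ) := by push_cast; positivity
  set Q : ℝ := ((m ^ L : ℕ) : ℝ) ^ θ with hQ
  have hQ0 : 0 < Q := Real.rpow_pos_of_pos hmL θ
  have hmQ : (m : ℝ) ≤ Q := by
    rw [hQ, natCast_pow_rpow]
    exact Real.self_le_rpow_of_one_le (by exact_mod_cast Nat.cast_pos.1 hm0) hL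
  have hdev : |(numDistinct w (m ^ L) : ℝ) - D * Q| ≤ (q + 4) * (Q / m) := by
    have hmean : q + 3 ≤ (q + 3) * (Q / m) :=
      le_mul_of_one_le_right (by linarith) ((one_le_div₀ hm0).2 hmQ)
    refine (abs_sub_le _ (meanDistinct θ q (m ^ L)) _).trans
      ((add_le_add (hw m hm) ((abs_meanDistinct_sub_le h0 h1 hq _).trans hmean)).trans_eq ?_)
    ring
  have hratio : |(numDistinct w (m ^ L) : ℝ) / (D * Q) - 1| ≤ (q + 4) / D / m := by
    rw [div_sub_one (by positivity), abs_div, abs_of_pos (by positivity : 0 < D * Q),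
      div_le_iff₀ (by positivity)]
    refine hdev.trans_eq ?_
    field_simp
  have hR : (0 : ℝ) < numDistinct w (m ^ L) := by
    exact_mod_cast numDistinct_pos w (Nat.cast_pos.1 hmL).ne'
  have hlog : Real.log (numDistinct w (m ^ L)) - (Real.log D + θ * Real.log ((m ^ L : ℕ) : ℝ)) =
      Real.log ((numDistinct w (m ^ L) : ℝ) / (D * Q)) := by
    rw [Real.log_div hR.ne' (by positivity), Real.log_mul hD.ne' hQ0.ne', hQ, Real.log_rpow hmL]
  rw [hlog, mul_div_assoc]
  refine (abs_log_le_two_mul_abs_sub_one (hratio.trans ?_)).trans (by linarith)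
  rw [div_le_iff₀ hm0]
  have hmM : (M : ℝ) ≤ m := by exact_mod_cast hm
  linarith

lemma exists_abs_log_numDistinct_sub_le {θ a : ℝ} (h0 : 0 < θ) (h1 : θ < 1) (ha : -1 < a) (b : ℝ)
    {L : ℕ} (hL : 1 ≤ L * θ) :
    ∃ C M₀ : ℝ, 0 ≤ C ∧ ∀ M : ℕ, M₀ ≤ M → ∀ q ∈ Set.Icc a b, ∀ w, FollowsMean θ q L M w →
      ∀ k ≥ M ^ L, |Real.log (numDistinct w k) - (Real.log (growthCoeff θ q) +
        θ * Real.log k)| ≤ C * (k : ℝ) ^ (-(1 / (L : ℝ))) := by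
  rcases lt_or_ge b a with hba | hab
  · exact ⟨0, 0, le_rfl, fun M _ q hq => absurd (hq.1.trans hq.2) hba.not_ge⟩
  have hL0 : L ≠ 0 := by
    rintro rfl
    norm_num at hL
  have hDa := growthCoeff_pos h0 h1 ha
  set E := 2 * ((b + 4) / growthCoeff θ a) with hE
  have hE0 : 0 ≤ E := by
    have : 0 < b + 4 := by linarith
    positivity
  refine ⟨2 * (E + θ * L), max E 1, by positivity, fun M hM q hq w hw => ?_⟩
  have hqa : -1 < q := ha.trans_le hq.1
  have hqE : 2 * ((q + 4) / growthCoeff θ q) ≤ E := by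
    have hmono := (strictMonoOn_growthCoeff h0 h1).monotoneOn ha hqa hq.1
    rw [hE]
    gcongr
    exacts [by linarith, hq.2]
  refine abs_sub_le_of_monotone_of_pow (monotone_log_numDistinct w) h0.le hE0 hL0
    (by exact_mod_cast (le_max_right E 1).trans hM) fun m hm =>
    (hw.abs_log_sub_le h0 h1 hqa hL (hqE.trans ((le_max_left E 1).trans hM)) hm).trans ?_
  gcongr

lemma abs_sub_floor_le {g : ℕ → ℝ} {κ θ C γ : ℝ} (hθ : 0 ≤ θ) (hC : 0 ≤ C) (hγ0 : 0 ≤ γ)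
    (hγ1 : γ ≤ 1) {K : ℕ} (hg : ∀ k ≥ K, |g k - (κ + θ * Real.log k)| ≤ C * (k : ℝ) ^ (-γ))
    {x : ℝ} (hx : K + 2 ≤ x) :
    |g ⌊x⌋₊ - (κ + θ * Real.log x)| ≤ (C + θ) * (x / 2) ^ (-γ) := by
  have := K.cast_nonneg (α := ℝ)
  set k := ⌊x⌋₊
  have hkx : (k : ℝ) ≤ x := Nat.floor_le (by linarith)
  have hxk : x < k + 1 := Nat.lt_floor_add_one x
  have hKk : K ≤ k := Nat.le_floor (by linarith)
  have hk1 : (1 : ℝ) ≤ k := by linarith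
  have hk0 : (0 : ℝ) < k := by linarith
  have hlog_le : Real.log k ≤ Real.log x := Real.log_le_log hk0 hkx
  have hlog : Real.log x - Real.log k ≤ (k : ℝ) ^ (-γ) :=
    calc Real.log x - Real.log k ≤ Real.log (k + 1) - Real.log k :=
          sub_le_sub_right (Real.log_le_log (by linarith) hxk.le) _
      _ ≤ (k : ℝ) ^ (-1 : ℝ) := by
          simpa only [Real.rpow_neg_one, one_div] using log_add_one_sub_log_le hk0
      _ ≤ (k : ℝ) ^ (-γ) := Real.rpow_le_rpow_of_exponent_le hk1 (by linarith)
  calc |g k - (κ + θ * Real.log x)|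
      = |(g k - (κ + θ * Real.log k)) - θ * (Real.log x - Real.log k)| := by ring_nf
    _ ≤ C * (k : ℝ) ^ (-γ) + θ * (k : ℝ) ^ (-γ) := by
        refine (abs_sub _ _).trans (add_le_add (hg k hKk) ?_)
        rw [abs_of_nonneg (mul_nonneg hθ (sub_nonneg.2 hlog_le))]
        exact mul_le_mul_of_nonneg_left hlog hθ
    _ = (C + θ) * (k : ℝ) ^ (-γ) := by ring
    _ ≤ (C + θ) * (x / 2) ^ (-γ) := by
        refine mul_le_mul_of_nonneg_left ?_ (by positivity)
        exact Real.rpow_le_rpow_of_nonpos (by linarith) (by linarith) (by linarith)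

lemma IsWeight.exists_abs_thetaHat_sub_le {A : ℝ → ℝ} (hA : IsWeight A) {θ C γ : ℝ} (hθ : 0 ≤ θ)
    (hC : 0 ≤ C) (hγ0 : 0 ≤ γ) (hγ1 : γ ≤ 1) :
    ∃ C' : ℝ, ∀ K : ℕ, ∀ᶠ n : ℕ in atTop, ∀ (w : ℕ → ℕ) (κ : ℝ),
      (∀ k ≥ K, |Real.log (numDistinct w k) - (κ + θ * Real.log k)| ≤ C * (k : ℝ) ^ (-γ)) →
      |thetaHat A w n - θ| ≤ C' * (n : ℝ) ^ (-γ) := by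
  obtain ⟨δ, V, hδ0, -, hV⟩ := hA.exists_abs_stieltjesIntegral_sub_le
  refine ⟨(C + θ) * (δ / 2) ^ (-γ) * V, fun K => ?_⟩
  filter_upwards [eventually_gt_atTop 0,
    (tendsto_natCast_atTop_atTop.atTop_mul_const hδ0).eventually_ge_atTop ((K : ℝ) + 2)]
    with n hn hnδ w κ hw
  have hn0 : (0 : ℝ) < n := by exact_mod_cast hn
  have hmeas : Measurable fun t : ℝ => Real.posLog (numDistinct w ⌊(n : ℝ) * t⌋₊) :=
    (measurable_from_nat (f := fun k => Real.posLog (numDistinct w k))).comp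
      (Nat.measurable_floor.comp (measurable_const_mul _))
  refine (hV _ (κ + θ * Real.log n) θ ((C + θ) * (n * δ / 2) ^ (-γ)) hmeas fun t ht => ?_).trans_eq
    ?_
  · have ht0 : 0 < t := hδ0.trans_le ht.1
    have hnt : n * δ ≤ n * t := mul_le_mul_of_nonneg_left ht.1 hn0.le
    have hfloor := abs_sub_floor_le hθ hC hγ0 hγ1 hw (hnδ.trans hnt)
    rw [Real.log_mul hn0.ne' ht0.ne', mul_add, ← add_assoc] at hfloor
    rw [Real.log_of_nat_eq_posLog]
    refine hfloor.trans (mul_le_mul_of_nonneg_left ?_ (by positivity))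
    exact Real.rpow_le_rpow_of_nonpos (by positivity) (by linarith) (by linarith)
  · rw [mul_div_assoc, Real.mul_rpow hn0.le (by positivity)]
    ring

lemma tendsto_meanDistinct_div_rpow {ι : Type*} {l : Filter ι} {τ : ι → ℝ} {n : ι → ℕ} {θ x : ℝ}
    (h0 : 0 < θ) (h1 : θ < 1) (hx : -1 < x) (hn : Tendsto n l atTop)
    (hτ : Tendsto (fun i => (τ i - θ) * Real.log (n i)) l (𝓝 0)) :
    Tendsto (fun i => meanDistinct (τ i) x (n i) / (n i : ℝ) ^ θ) l (𝓝 (growthCoeff θ x)) := by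
  have hn' : Tendsto (fun i => (n i : ℝ)) l atTop := tendsto_natCast_atTop_atTop.comp hn
  have hlog : Tendsto (fun i => Real.log (n i)) l atTop := Real.tendsto_log_atTop.comp hn'
  have hτθ : Tendsto τ l (𝓝 θ) := by
    have hdiff : Tendsto (fun i => τ i - θ) l (𝓝 0) := by
      refine (hτ.div_atTop hlog).congr' ?_
      filter_upwards [hlog.eventually_gt_atTop 0] with i hi
      exact mul_div_cancel_right₀ _ hi.ne'
    simpa only [sub_add_cancel, zero_add] using hdiff.add_const θ
  have hpow : Tendsto (fun i => growthCoeff (τ i) x * Real.exp ((τ i - θ) * Real.log (n i))) l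
      (𝓝 (growthCoeff θ x)) := by
    have hexp := (Real.continuous_exp.tendsto 0).comp hτ
    rw [Real.exp_zero] at hexp
    simpa only [mul_one, Function.comp_def] using
      ((continuousAt_growthCoeff h0 h1 hx).tendsto.comp hτθ).mul hexp
  have herr : Tendsto (fun i => (x + 3) / (n i : ℝ) ^ θ) l (𝓝 0) :=
    ((tendsto_rpow_atTop h0).comp hn').const_div_atTop _
  refine tendsto_of_tendsto_of_dist hpow (squeeze_zero' (.of_forall fun _ => dist_nonneg) ?_ herr)
  filter_upwards [hτθ.eventually_const_lt h0, hτθ.eventually_lt_const h1,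
    hn'.eventually_gt_atTop 0] with i hi0 hi1 hni
  have hexp : Real.exp ((τ i - θ) * Real.log (n i)) = (n i : ℝ) ^ τ i / (n i : ℝ) ^ θ := by
    rw [mul_comm, ← Real.rpow_def_of_pos hni, Real.rpow_sub hni]
  rw [hexp, ← mul_div_assoc, dist_comm, Real.dist_eq, ← sub_div, abs_div,
    abs_of_pos (Real.rpow_pos_of_pos hni θ)]
  gcongr
  exact abs_meanDistinct_sub_le hi0 hi1 hx _

lemma tendsto_mul_rpow_neg_mul_log (C : ℝ) {γ : ℝ} (hγ : 0 < γ) :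
    Tendsto (fun n : ℕ => C * (n : ℝ) ^ (-γ) * Real.log n) atTop (𝓝 0) := by
  have hlog := ((isLittleO_log_rpow_atTop hγ).tendsto_div_nhds_zero.const_mul C).comp
    tendsto_natCast_atTop_atTop
  rw [mul_zero] at hlog
  refine hlog.congr fun n => ?_
  rw [Function.comp_apply, Real.rpow_neg n.cast_nonneg]
  ring

lemma eventually_meanDistinct_div_rpow_mem {θ x C γ : ℝ} (h0 : 0 < θ) (h1 : θ < 1) (hx : -1 < x)
    (hγ : 0 < γ) {U : Set ℝ} (hU : U ∈ 𝓝 (growthCoeff θ x)) :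
    ∀ᶠ n : ℕ in atTop, ∀ τ : ℝ, |τ - θ| ≤ C * (n : ℝ) ^ (-γ) →
      meanDistinct τ x n / (n : ℝ) ^ θ ∈ U := by
  have key : ∀ᶠ i : ℝ × ℕ in comap Prod.snd atTop ⊓ 𝓟 {i | |i.1 - θ| ≤ C * (i.2 : ℝ) ^ (-γ)},
      meanDistinct i.1 x i.2 / (i.2 : ℝ) ^ θ ∈ U := by
    have hn : Tendsto Prod.snd (comap (Prod.snd : ℝ × ℕ → ℕ) atTop ⊓
        𝓟 {i | |i.1 - θ| ≤ C * (i.2 : ℝ) ^ (-γ)}) atTop := tendsto_comap.mono_left inf_le_left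
    refine (tendsto_meanDistinct_div_rpow h0 h1 hx hn (squeeze_zero_norm' ?_
      ((tendsto_mul_rpow_neg_mul_log C hγ).comp hn))).eventually_mem hU
    filter_upwards [mem_inf_of_right (mem_principal_self _)] with i hi
    rw [norm_mul, Real.norm_eq_abs, Real.norm_of_nonneg (Real.log_natCast_nonneg _)]
    exact mul_le_mul_of_nonneg_right hi (Real.log_natCast_nonneg _)
  rw [eventually_inf_principal, eventually_comap] at key
  exact key.mono fun n hn τ hτ => hn (τ, n) rfl hτ

lemma tendsto_mul_rpow_neg (C : ℝ) {γ : ℝ} (hγ : 0 < γ) :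
    Tendsto (fun n : ℕ => C * (n : ℝ) ^ (-γ)) atTop (𝓝 0) := by
  simpa only [mul_zero, Function.comp_def] using
    ((tendsto_rpow_neg_atTop hγ).comp tendsto_natCast_atTop_atTop).const_mul C

lemma eventually_mul_rpow_lt_and_lt {θ a b c₀ c₁ C γ : ℝ} (h0 : 0 < θ) (h1 : θ < 1) (ha : -1 < a)
    (hγ : 0 < γ) (hc₀ : c₀ < growthCoeff θ a) (hc₁ : growthCoeff θ b < c₁) :
    ∀ᶠ n : ℕ in atTop, ∀ q ∈ Set.Icc a b, ∀ R : ℝ, 0 < R →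
      |Real.log R - (Real.log (growthCoeff θ q) + θ * Real.log n)| ≤ C * (n : ℝ) ^ (-γ) →
      c₀ * (n : ℝ) ^ θ < R ∧ R < c₁ * (n : ℝ) ^ θ := by
  have herr := tendsto_mul_rpow_neg C hγ
  have hlow : Tendsto (fun n : ℕ => growthCoeff θ a * Real.exp (-(C * (n : ℝ) ^ (-γ)))) atTop
      (𝓝 (growthCoeff θ a)) := by
    simpa using ((Real.continuous_exp.tendsto _).comp herr.neg).const_mul (growthCoeff θ a)
  have hupp : Tendsto (fun n : ℕ => growthCoeff θ b * Real.exp (C * (n : ℝ) ^ (-γ))) atTop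
      (𝓝 (growthCoeff θ b)) := by
    simpa using ((Real.continuous_exp.tendsto _).comp herr).const_mul (growthCoeff θ b)
  filter_upwards [hlow.eventually_const_lt hc₀, hupp.eventually_lt_const hc₁,
    eventually_gt_atTop 0] with n hn₀ hn₁ hn q hq R hR hlogR
  have hq1 : -1 < q := ha.trans_le hq.1
  have hb : -1 < b := hq1.trans_le hq.2
  have hD := growthCoeff_pos h0 h1 hq1
  have hmono := (strictMonoOn_growthCoeff h0 h1).monotoneOn
  have hnθ : (0 : ℝ) < (n : ℝ) ^ θ := Real.rpow_pos_of_pos (by exact_mod_cast hn) θ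
  set r := Real.log R - (Real.log (growthCoeff θ q) + θ * Real.log n) with hr
  have hRr : R = growthCoeff θ q * Real.exp r * (n : ℝ) ^ θ := by
    have hlog : Real.log R = Real.log (growthCoeff θ q) + r + Real.log n * θ := by
      rw [hr]
      ring
    rw [Real.rpow_def_of_pos (by exact_mod_cast hn), ← Real.exp_log hR, hlog, Real.exp_add,
      Real.exp_add, Real.exp_log hD]
  rw [hRr]
  constructor
  · refine mul_lt_mul_of_pos_right (hn₀.trans_le ?_) hnθ
    gcongr
    exacts [hmono ha hq1 hq.1, (abs_le.1 hlogR).1]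
  · refine mul_lt_mul_of_pos_right (lt_of_le_of_lt ?_ hn₁) hnθ
    gcongr
    exacts [(growthCoeff_pos h0 h1 hb).le, hmono hq1 hb hq.2, (abs_le.1 hlogR).2]

lemma eventually_meanDistinct_lt_and_lt {θ a b x₀ x₁ C C' γ : ℝ} (h0 : 0 < θ) (h1 : θ < 1)
    (hx₀ : -1 < x₀) (hxa : x₀ < a) (hab : a ≤ b) (hbx : b < x₁) (hγ : 0 < γ) (V : ℝ) :
    ∀ᶠ n : ℕ in atTop, ∀ q ∈ Set.Icc a b, ∀ τ R : ℝ, 0 < R → |τ - θ| ≤ C' * (n : ℝ) ^ (-γ) →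
      |Real.log R - (Real.log (growthCoeff θ q) + θ * Real.log n)| ≤ C * (n : ℝ) ^ (-γ) →
      meanDistinct τ x₀ n < R ∧ R < meanDistinct τ x₁ n ∧ V ≤ R := by
  have ha : -1 < a := hx₀.trans hxa
  have hb : -1 < b := ha.trans_le hab
  have hx₁ : -1 < x₁ := hb.trans hbx
  obtain ⟨c₀, hc₀, hc₀a⟩ := exists_between (strictMonoOn_growthCoeff h0 h1 hx₀ ha hxa)
  obtain ⟨c₁, hbc₁, hc₁⟩ := exists_between (strictMonoOn_growthCoeff h0 h1 hb hx₁ hbx)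
  have hV : Tendsto (fun n : ℕ => c₀ * (n : ℝ) ^ θ) atTop atTop :=
    ((tendsto_rpow_atTop h0).comp tendsto_natCast_atTop_atTop).const_mul_atTop
      ((growthCoeff_pos h0 h1 hx₀).trans hc₀)
  filter_upwards [eventually_mul_rpow_lt_and_lt h0 h1 ha hγ hc₀a hbc₁,
    eventually_meanDistinct_div_rpow_mem (C := C') h0 h1 hx₀ hγ (Iio_mem_nhds hc₀),
    eventually_meanDistinct_div_rpow_mem (C := C') h0 h1 hx₁ hγ (Ioi_mem_nhds hc₁),
    hV.eventually_ge_atTop V, eventually_gt_atTop 0]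
    with n hR hn₀ hn₁ hnV hn q hq τ R hR0 hτ hlogR
  have hnθ : (0 : ℝ) < (n : ℝ) ^ θ := Real.rpow_pos_of_pos (by exact_mod_cast hn) θ
  obtain ⟨hRlow, hRupp⟩ := hR q hq R hR0 hlogR
  exact ⟨((div_lt_iff₀ hnθ).1 (hn₀ τ hτ)).trans hRlow,
    hRupp.trans ((lt_div_iff₀ hnθ).1 (hn₁ τ hτ)), hnV.trans hRlow.le⟩

lemma abs_interpolate_sub_le {u v : ℕ → ℝ} {n : ℕ} {t E : ℝ} (ht : t ∈ Set.Icc (0 : ℝ) 1)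
    (h : ∀ k ≤ n + 1, |u k - v k| ≤ E) : |interpolate u n t - interpolate v n t| ≤ E := by
  unfold interpolate
  set k := ⌊(n : ℝ) * t⌋₊
  have hkn : k ≤ n := Nat.floor_le_of_le (mul_le_of_le_one_right n.cast_nonneg ht.2)
  set s := (n : ℝ) * t - k
  have hs0 : 0 ≤ s := sub_nonneg.2 (Nat.floor_le (mul_nonneg n.cast_nonneg ht.1))
  have hs1 : 0 ≤ 1 - s := by linarith [Nat.lt_floor_add_one ((n : ℝ) * t)]
  calc _ = |(1 - s) * (u k - v k) + s * (u (k + 1) - v (k + 1))| := by ring_nf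
    _ ≤ (1 - s) * |u k - v k| + s * |u (k + 1) - v (k + 1)| := by
        refine (abs_add_le _ _).trans_eq ?_
        rw [abs_mul, abs_mul, abs_of_nonneg hs0, abs_of_nonneg hs1]
    _ ≤ (1 - s) * E + s * E := by
        gcongr
        exacts [h k (by omega), h (k + 1) (by omega)]
    _ = E := by ring

lemma abs_meanDistinct_sub_rpow_mul_le {τ x : ℝ} (h0 : 0 < τ) (h1 : τ < 1) (hx : -1 < x) {k n : ℕ}
    (hn : n ≠ 0) (hk : k ≤ n + 1) :
    |meanDistinct τ x k - ((k : ℝ) / n) ^ τ * meanDistinct τ x n| ≤ 3 * (x + 3) := by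
  have hn0 : (0 : ℝ) < n := by positivity
  have hkn : (k : ℝ) / n ≤ 2 := by
    rw [div_le_iff₀ hn0]
    exact_mod_cast (by omega : k ≤ 2 * n)
  have hpow : ((k : ℝ) / n) ^ τ ≤ 2 := by
    rcases le_total ((k : ℝ) / n) 1 with hle | hle
    · exact (Real.rpow_le_one (by positivity) hle h0.le).trans one_le_two
    · exact (Real.rpow_le_self_of_one_le hle h1.le).trans hkn
  have hmul : ((k : ℝ) / n) ^ τ * (n : ℝ) ^ τ = (k : ℝ) ^ τ := by
    rw [← Real.mul_rpow (by positivity) hn0.le, div_mul_cancel₀ _ hn0.ne']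
  calc _ = |(meanDistinct τ x k - growthCoeff τ x * (k : ℝ) ^ τ) -
        ((k : ℝ) / n) ^ τ * (meanDistinct τ x n - growthCoeff τ x * (n : ℝ) ^ τ)| := by
          rw [← hmul]
          ring_nf
    _ ≤ (x + 3) + 2 * (x + 3) := by
        refine (abs_sub _ _).trans (add_le_add (abs_meanDistinct_sub_le h0 h1 hx k) ?_)
        rw [abs_mul, abs_of_nonneg (by positivity)]
        exact mul_le_mul hpow (abs_meanDistinct_sub_le h0 h1 hx n) (abs_nonneg _) zero_le_two
    _ = 3 * (x + 3) := by ring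

lemma IsShiftEstimate.abs_bridge_sub_le {A : ℝ → ℝ} {w : ℕ → ℕ} {n : ℕ} {x : ℝ} (hn : n ≠ 0)
    (h : IsShiftEstimate A w n x) {t : ℝ} (ht : t ∈ Set.Icc (0 : ℝ) 1) :
    |powerBridge A w n t - textBridge A w n x t| ≤ 3 * (x + 3) / √(numDistinct w n : ℝ) := by
  obtain ⟨h0, h1, hx, hr⟩ := h
  refine abs_interpolate_sub_le ht fun k hk => ?_
  rw [← sub_div, sub_sub_sub_cancel_left, ← hr, abs_div, abs_of_nonneg (Real.sqrt_nonneg _)]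
  gcongr
  exact abs_meanDistinct_sub_rpow_mul_le h0 h1 hx hn hk

/-- At time `n` a shift estimate exists, and for each of its values the two bridges are uniformly
`ε`-close. -/
def BridgesAgreeAt (A : ℝ → ℝ) (w : ℕ → ℕ) (ε : ℝ) (n : ℕ) : Prop :=
  (∃ x, IsShiftEstimate A w n x) ∧ ∀ x, IsShiftEstimate A w n x →
    ∀ t ∈ Set.Icc (0 : ℝ) 1, |powerBridge A w n t - textBridge A w n x t| ≤ ε

lemma bridgesAgreeAt_of_meanDistinct_lt {A : ℝ → ℝ} {w : ℕ → ℕ} {n : ℕ} {ε x₀ x₁ : ℝ}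
    (h0 : 0 < thetaHat A w n) (h1 : thetaHat A w n < 1) (hx₀ : -1 < x₀) (hx : x₀ ≤ x₁)
    (hlow : meanDistinct (thetaHat A w n) x₀ n < numDistinct w n)
    (hupp : numDistinct w n < meanDistinct (thetaHat A w n) x₁ n) (hε : 0 < ε) (hn : n ≠ 0)
    (hR : (3 * (x₁ + 3) / ε) ^ 2 ≤ numDistinct w n) : BridgesAgreeAt A w ε n := by
  refine ⟨?_, fun x hx' t ht => (hx'.abs_bridge_sub_le hn ht).trans ?_⟩
  · obtain ⟨x, hx, hxR⟩ := intermediate_value_Icc hx (continuousOn_meanDistinct h0 h1 hx₀ n)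
      ⟨hlow.le, hupp.le⟩
    exact ⟨x, h0, h1, hx₀.trans_le hx.1, hxR⟩
  · have hxx₁ : x ≤ x₁ := by
      by_contra! hlt
      exact (hupp.trans_le (meanDistinct_mono h0 h1 (hx₀.trans_le hx) hlt.le n)).ne' hx'.2.2.2
    have hR0 : (0 : ℝ) < numDistinct w n := by exact_mod_cast numDistinct_pos w hn
    rw [div_le_iff₀ (Real.sqrt_pos.2 hR0), ← div_le_iff₀' hε]
    refine le_trans ?_ (Real.le_sqrt_of_sq_le hR)
    gcongr

lemma exists_forall_bridgesAgreeAt_of_followsMean {A : ℝ → ℝ} (hA : IsWeight A) {θ a : ℝ}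
    (h0 : 0 < θ) (h1 : θ < 1) (ha : -1 < a) (b : ℝ) {L : ℕ} (hL : 1 ≤ L * θ) {ε : ℝ} (hε : 0 < ε) :
    ∃ M₀ : ℝ, ∀ M : ℕ, M₀ ≤ M → ∀ᶠ n in atTop, ∀ q ∈ Set.Icc a b, ∀ w,
      FollowsMean θ q L M w → BridgesAgreeAt A w ε n := by
  rcases lt_or_ge b a with hba | hab
  · exact ⟨0, fun _ _ => .of_forall fun _ q hq => absurd (hq.1.trans hq.2) hba.not_ge⟩
  have hL1 : (1 : ℝ) ≤ L := by
    rw [Nat.one_le_cast, Nat.one_le_iff_ne_zero]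
    rintro rfl
    norm_num at hL
  have hγ : 0 < 1 / (L : ℝ) := by positivity
  obtain ⟨C, M₀, hC, hlog⟩ := exists_abs_log_numDistinct_sub_le h0 h1 ha b hL
  obtain ⟨C', htheta⟩ := hA.exists_abs_thetaHat_sub_le h0.le hC hγ.le
    ((div_le_one₀ (by linarith)).2 hL1)
  obtain ⟨x₀, hx₀, hx₀a⟩ := exists_between ha
  refine ⟨M₀, fun M hM => ?_⟩
  have hclose : ∀ᶠ n : ℕ in atTop, C' * (n : ℝ) ^ (-(1 / (L : ℝ))) < min θ (1 - θ) :=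
    (tendsto_mul_rpow_neg C' hγ).eventually_lt_const (lt_min h0 (sub_pos.2 h1))
  filter_upwards [htheta (M ^ L), hclose, eventually_ge_atTop (M ^ L), eventually_ne_atTop 0,
    eventually_meanDistinct_lt_and_lt (C := C) (C' := C') h0 h1 hx₀ hx₀a hab (lt_add_one b) hγ
      ((3 * (b + 1 + 3) / ε) ^ 2)] with n htheta hclose hMn hn hmean q hq w hw
  have hlogw := hlog M hM q hq w hw
  have hτ := htheta w _ hlogw
  have hτ' := abs_lt.1 (hτ.trans_lt hclose)
  obtain ⟨hlow, hupp, hR⟩ := hmean q hq _ _ (by exact_mod_cast numDistinct_pos w hn) hτ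
    (hlogw n hMn)
  exact bridgesAgreeAt_of_meanDistinct_lt
    (by linarith [min_le_left θ (1 - θ)]) (by linarith [min_le_right θ (1 - θ)])
    hx₀ (by linarith) hlow hupp hε hn hR

lemma IsZMText.measure_deviation_pow_le {Ω : Type*} [MeasurableSpace Ω] {P : Measure Ω}
    {X : ℕ → Ω → ℕ} {θ q : ℝ} (h : IsZMText P X θ q) (h0 : 0 < θ) (h1 : θ < 1) (hq : -1 < q)
    {L m : ℕ} (hL : 4 ≤ L * θ) (hm : 1 ≤ m) :
    P {ω | ((m ^ L : ℕ) : ℝ) ^ θ / m ≤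
        |(numDistinct (fun j => X j ω) (m ^ L) : ℝ) - meanDistinct θ q (m ^ L)|} ≤
      ENNReal.ofReal ((growthCoeff θ q + (q + 3)) / (m : ℝ) ^ 2) := by
  have hm1 : (1 : ℝ) ≤ m := by exact_mod_cast hm
  set Q : ℝ := ((m ^ L : ℕ) : ℝ) ^ θ with hQ
  have hmQ : (m : ℝ) ^ 4 ≤ Q := by
    rw [hQ, natCast_pow_rpow, ← Real.rpow_natCast]
    exact Real.rpow_le_rpow_of_exponent_le hm1 hL
  have hQ1 : 1 ≤ Q := (one_le_pow₀ hm1).trans hmQ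
  have hmean : meanDistinct θ q (m ^ L) ≤ (growthCoeff θ q + (q + 3)) * Q := by
    have herr := (abs_le.1 (abs_meanDistinct_sub_le h0 h1 hq (m ^ L))).2
    have : q + 3 ≤ (q + 3) * Q := le_mul_of_one_le_right (by linarith) hQ1
    linarith
  have hc : 0 < growthCoeff θ q + (q + 3) := by linarith [growthCoeff_pos h0 h1 hq]
  refine (h.measure_deviation_le h0 h1 hq (m ^ L) (by positivity)).trans
    (ENNReal.ofReal_le_ofReal ?_)
  calc meanDistinct θ q (m ^ L) / (Q / m) ^ 2
      ≤ (growthCoeff θ q + (q + 3)) * Q / (Q / m) ^ 2 := by gcongr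
    _ = (growthCoeff θ q + (q + 3)) * (m : ℝ) ^ 2 / Q := by field_simp
    _ ≤ (growthCoeff θ q + (q + 3)) * (m : ℝ) ^ 2 / (m : ℝ) ^ 4 := by gcongr
    _ = (growthCoeff θ q + (q + 3)) / (m : ℝ) ^ 2 := by field_simp

lemma IsZMText.measure_not_followsMean_le {Ω : Type*} [MeasurableSpace Ω] {P : Measure Ω}
    {X : ℕ → Ω → ℕ} {θ q b : ℝ} (h : IsZMText P X θ q) (h0 : 0 < θ) (h1 : θ < 1) (hq : -1 < q)
    (hqb : q ≤ b) {L M : ℕ} (hL : 4 ≤ L * θ) (hM : 1 ≤ M) :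
    P {ω | ¬ FollowsMean θ q L M fun j => X j ω} ≤
      ∑' i : ℕ, ENNReal.ofReal ((growthCoeff θ b + (b + 3)) / ((i + M : ℕ) : ℝ) ^ 2) := by
  have hsub : {ω | ¬ FollowsMean θ q L M fun j => X j ω} ⊆
      ⋃ i : ℕ, {ω | (((i + M) ^ L : ℕ) : ℝ) ^ θ / (i + M : ℕ) ≤
        |(numDistinct (fun j => X j ω) ((i + M) ^ L) : ℝ) - meanDistinct θ q ((i + M) ^ L)|} := by
    intro ω hω
    simp only [FollowsMean, Set.mem_ofPred_eq, not_forall, not_le] at hω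
    obtain ⟨m, hm, hlt⟩ := hω
    refine Set.mem_iUnion.2 ⟨m - M, ?_⟩
    simpa only [Set.mem_ofPred_eq, Nat.sub_add_cancel hm] using hlt.le
  refine (measure_mono hsub).trans ((measure_iUnion_le _).trans (ENNReal.tsum_le_tsum fun i =>
    (h.measure_deviation_pow_le h0 h1 hq hL (by omega)).trans (ENNReal.ofReal_le_ofReal ?_)))
  have := (strictMonoOn_growthCoeff h0 h1).monotoneOn hq (hq.trans_le hqb) hqb
  gcongr

lemma tendsto_iSup_measure_not_bridgesAgreeAt {θ : ℝ} (h0 : 0 < θ) (h1 : θ < 1) {A : ℝ → ℝ}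
    (hA : IsWeight A) {a b : ℝ} (ha : -1 < a) {Ω : ℝ → Type*} [∀ q, MeasurableSpace (Ω q)]
    {P : ∀ q, Measure (Ω q)} {X : ∀ q, ℕ → Ω q → ℕ}
    (hX : ∀ q ∈ Set.Icc a b, IsZMText (P q) (X q) θ q) {ε : ℝ} (hε : 0 < ε) :
    Tendsto (fun N : ℕ => ⨆ q ∈ Set.Icc a b,
      P q {ω | ∃ n ≥ N, ¬ BridgesAgreeAt A (fun j => X q j ω) ε n}) atTop (𝓝 0) := by
  obtain ⟨L, hL⟩ : ∃ L : ℕ, 4 ≤ L * θ := by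
    obtain ⟨L, hL⟩ := exists_nat_ge (4 / θ)
    exact ⟨L, (div_le_iff₀ h0).1 hL⟩
  obtain ⟨M₀, hagree⟩ :=
    exists_forall_bridgesAgreeAt_of_followsMean hA h0 h1 ha b (by linarith : 1 ≤ L * θ) hε
  have hsum : ∑' i : ℕ, ENNReal.ofReal ((growthCoeff θ b + (b + 3)) / (i : ℝ) ^ 2) ≠ ⊤ := by
    have hsq := (Real.summable_nat_pow_inv.2 one_lt_two).mul_left (growthCoeff θ b + (b + 3))
    exact Summable.tsum_ofReal_ne_top (by simpa only [div_eq_mul_inv] using hsq)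
  have htail := ENNReal.tendsto_sum_nat_add _ hsum
  rw [ENNReal.tendsto_nhds_zero] at htail ⊢
  intro η hη
  obtain ⟨M, hMη, hM₀, hM⟩ := ((htail η hη).and
    ((tendsto_natCast_atTop_atTop.eventually_ge_atTop M₀).and (eventually_ge_atTop 1))).exists
  obtain ⟨N, hN⟩ := eventually_atTop.1 (hagree M hM₀)
  filter_upwards [eventually_ge_atTop N] with N' hN'
  refine iSup₂_le fun q hq => ((measure_mono ?_).trans ((hX q hq).measure_not_followsMean_le
    h0 h1 (ha.trans_le hq.1) hq.2 hL hM)).trans hMη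
  rintro ω ⟨n, hn, hbad⟩ hfollows
  exact hbad (hN n (hN'.trans hn) q hq _ hfollows)

lemma ae_eventually_of_tendsto_measure {α : Type*} [MeasurableSpace α] {μ : Measure α}
    {p : ℕ → α → Prop} (h : Tendsto (fun N => μ {ω | ∃ n ≥ N, ¬ p n ω}) atTop (𝓝 0)) :
    ∀ᵐ ω ∂μ, ∀ᶠ n in atTop, p n ω := by
  rw [ae_iff]
  refine le_antisymm (ge_of_tendsto' h fun N => measure_mono fun ω hω => ?_) zero_le
  by_contra hcon
  simp only [Set.mem_ofPred_eq, not_exists, not_and, not_not] at hcon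
  exact hω (eventually_atTop.2 ⟨N, hcon⟩)

lemma tendstoUniformlyOn_powerBridge_sub_textBridge {A : ℝ → ℝ} {w : ℕ → ℕ}
    (h : ∀ ε > 0, ∀ᶠ n in atTop, BridgesAgreeAt A w ε n) {x : ℕ → ℝ}
    (hx : ∀ᶠ n in atTop, IsShiftEstimate A w n (x n)) :
    TendstoUniformlyOn (fun n t => powerBridge A w n t - textBridge A w n (x n) t) (fun _ => 0)
      atTop (Set.Icc 0 1) := by
  rw [Metric.tendstoUniformlyOn_iff]
  intro ε hε
  filter_upwards [h (ε / 2) (half_pos hε), hx] with n hn hxn t ht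
  rw [dist_comm, Real.dist_eq, sub_zero]
  exact (hn.2 (x n) hxn t ht).trans_lt (half_lt_self hε)

lemma BridgesAgreeAt.mono {A : ℝ → ℝ} {w : ℕ → ℕ} {n : ℕ} {ε ε' : ℝ}
    (h : BridgesAgreeAt A w ε n) (hε : ε ≤ ε') : BridgesAgreeAt A w ε' n :=
  ⟨h.1, fun x hx t ht => (h.2 x hx t ht).trans hε⟩

lemma IsZMText.ae_eventually_bridgesAgreeAt {Ω : Type*} [MeasurableSpace Ω] {P : Measure Ω}
    {X : ℕ → Ω → ℕ} {θ q : ℝ} (h : IsZMText P X θ q) (h0 : 0 < θ) (h1 : θ < 1) (hq : -1 < q)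
    {A : ℝ → ℝ} (hA : IsWeight A) :
    ∀ᵐ ω ∂P, ∀ ε > 0, ∀ᶠ n in atTop, BridgesAgreeAt A (fun j => X j ω) ε n := by
  have hae (ε : ℝ) (hε : 0 < ε) :
      ∀ᵐ ω ∂P, ∀ᶠ n in atTop, BridgesAgreeAt A (fun j => X j ω) ε n := by
    have hunif := tendsto_iSup_measure_not_bridgesAgreeAt (a := q) (b := q) (Ω := fun _ => Ω)
      (P := fun _ => P) (X := fun _ => X) h0 h1 hA hq
      (fun q' hq' => by rwa [le_antisymm hq'.2 hq'.1]) hε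
    simp only [Set.Icc_self, iSup_singleton] at hunif
    exact ae_eventually_of_tendsto_measure hunif
  filter_upwards [ae_all_iff.2 fun j : ℕ => hae (1 / (j + 1)) Nat.one_div_pos_of_nat] with ω hω ε hε
  obtain ⟨j, hj⟩ := exists_nat_one_div_lt hε
  exact (hω j).mono fun n hn => hn.mono hj.le

end TextBridge

end

theorem theorem2p3 (θ : ℝ) (hθ0 : 0 < θ) (hθ1 : θ < 1)
    (A : ℝ → ℝ) (hA : TextBridge.IsWeight A)
    (a b : ℝ) (ha : -1 < a)
    {Ω : ℝ → Type*} [∀ q, MeasurableSpace (Ω q)]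
    (P : ∀ q, Measure (Ω q)) (X : ∀ q, ℕ → Ω q → ℕ)
    (hX : ∀ q ∈ Set.Icc a b, TextBridge.IsZMText (P q) (X q) θ q) :
    -- a.s. the shift estimate exists for all large `n`
    (∀ q ∈ Set.Icc a b, ∀ᵐ ω ∂(P q), ∀ᶠ n : ℕ in atTop,
      ∃ x, TextBridge.IsShiftEstimate A (fun j => X q j ω) n x) ∧
    -- a.s. the difference of the bridges tends to zero uniformly on `[0,1]`,
    -- for every choice of the shift estimates
    (∀ q ∈ Set.Icc a b, ∀ᵐ ω ∂(P q), ∀ x : ℕ → ℝ,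
      (∀ᶠ n : ℕ in atTop, TextBridge.IsShiftEstimate A (fun j => X q j ω) n (x n)) →
      TendstoUniformlyOn
        (fun n t => TextBridge.powerBridge A (fun j => X q j ω) n t -
          TextBridge.textBridge A (fun j => X q j ω) n (x n) t)
        (fun _ => 0) atTop (Set.Icc 0 1)) ∧
    -- almost sure existence and convergence are uniform in `q ∈ [a,b]`
    (∀ ε > 0, Tendsto
      (fun N : ℕ => ⨆ q ∈ Set.Icc a b, P q {ω | ∃ n ≥ N,
        ¬ ((∃ x, TextBridge.IsShiftEstimate A (fun j => X q j ω) n x) ∧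
          ∀ x, TextBridge.IsShiftEstimate A (fun j => X q j ω) n x →
            ∀ t ∈ Set.Icc (0 : ℝ) 1,
              |TextBridge.powerBridge A (fun j => X q j ω) n t -
                TextBridge.textBridge A (fun j => X q j ω) n x t| ≤ ε)})
      atTop (𝓝 0)) := by
  have hagree (q : ℝ) (hq : q ∈ Set.Icc a b) :=
    (hX q hq).ae_eventually_bridgesAgreeAt hθ0 hθ1 (ha.trans_le hq.1) hA
  refine ⟨fun q hq => ?_, fun q hq => ?_, fun ε hε =>
    TextBridge.tendsto_iSup_measure_not_bridgesAgreeAt hθ0 hθ1 hA ha hX hε⟩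
  · filter_upwards [hagree q hq] with ω hω
    exact (hω 1 one_pos).mono fun n hn => hn.1
  · filter_upwards [hagree q hq] with ω hω x hx
    exact TextBridge.tendstoUniformlyOn_powerBridge_sub_textBridge hω hx
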